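/- Consider transmission over the binary erasure channel (BEC) with erasure probability $\epsilon$, whose capacity is $1-\epsilon$. Let $\mathcal C$ be the rate-$1/2$ recursive systematic convolutional code with octal generator $(1,1/3)$, i.e. $(1,1/(1+D))$, and let $f_{\mathrm s}(x,y)$, $x,y\in[0,1]$, be its decoder transfer function for information bits: the limit, as the block length tends to infinity, of the average probability that the extrinsic output of the bitwise MAP (BCJR) decoder for an information bit is an erasure, when information and parity bits are erased at its input independently with probabilities $x$ and $y$. (This limit exists.) For integers $q\ge1$, $m\ge 0$, $L\ge1$ and $\rho\in[0,1]$, consider the generalized spatially coupled parallel concatenated code (GSC-PCC) ensemble with upper and lower component code $\mathcal C$ (mother code rate $R_0=1/3$), repetition factor $q$, repetition ratio $\lambda=1/q$, coupling memory $m$, coupling length $L$, and a fraction $\rho$ of surviving parity bits after random puncturing. Its density evolution over the BEC is, with $p^{(0)}_{\mathrm U,t}=p^{(0)}_{\mathrm L,t}=1$, with $\bar p^{(\ell)}_{\mathrm U,t}=\frac1{m+1}\sum_{j=0}^m p^{(\ell)}_{\mathrm U,t+j}$ for $1\le t\le L$ and $\bar p^{(\ell)}_{\mathrm U,t}=0$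 for all other $t\in\mathbb Z$, and likewise for $\mathrm L$, $$p^{(\ell)}_{\mathrm U,t}=f_{\mathrm s}\Big(\tfrac{\epsilon}{m+1}\sum_{k=0}^m\Big(q\lambda\big(\bar p^{(\ell-1)}_{\mathrm L,t-k}\big)^q\big(\bar p^{(\ell-1)}_{\mathrm U,t-k}\big)^{q-1}+(1-q\lambda)\,\bar p^{(\ell-1)}_{\mathrm L,t-k}\Big),\;1-(1-\epsilon)\rho\Big),$$ and the same with $\mathrm U$ and $\mathrm L$ interchanged. The BP threshold $\epsilon_{\mathrm{BP}}(q,\rho,m,L)$ is the supremum of the $\epsilon\in[0,1]$ for which $\bar p^{(\ell)}_{\mathrm U,t}\to0$ and $\bar p^{(\ell)}_{\mathrm L,t}\to0$ as $\ell\to\infty$ for all $1\le t\le L$. Let $0<R<1$ and $\rho_q=\frac{R_0(1-R)}{qR(1-R_0)}=\frac{1-R}{2qR}$. For every $q\ge1$ with $R\ge\frac1{2q+1}$ we have $\rho_q\in(0,1]$, and for every $m$ the code rate $$\frac{L(1-(q-1)\lambda)}{L(1-(q-1)\lambda)+(L+m)\left(\frac1{R_0}-1\right)\rho_q}$$ tends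 to $R$ as $L\to\infty$. Moreover, the ensemble achieves the BEC capacity under BP decoding as $q\to\infty$: for every $\delta>0$, for all sufficiently large $q$, for all sufficiently large $m$ (depending on $q$), and for all sufficiently large $L$ (depending on $q$ and $m$), $$\left|\epsilon_{\mathrm{BP}}(q,\rho_q,m,L)-(1-R)\right|<\delta .$$ -/

import Mathlib

open Filter Topology

namespace GSCPCC

/-! ### The 2-state component code and its transfer function -/

/-- Parity sequence of the rate-1/2 recursive systematic convolutional encoder with generator
`(1, 1/3)` in octal, that is `(1, 1/(1+D))`: the parity `v` of the input `u` satisfies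
`v_k + v_{k-1} = u_k`, started in the zero state. -/
def parity (u : ℕ → ZMod 2) : ℕ → ZMod 2
  | 0 => u 0
  | k + 1 => parity u k + u (k + 1)

/-- Blocks of length `n` (positions `0, …, n-1`); the information bits at the positions in `A` and
the parity bits at the positions in `B` are erased at the decoder input. The extrinsic output of
the BCJR (bitwise MAP) decoder for the information bit `k` is an erasure: bit `k` is not determined
by the non-erased parity bits and the non-erased information bits other than `k`. The code is
linear, so this says that some codeword which vanishes at all those positions has a one there. -/
def ExtrinsicErased (n : ℕ) (A B : Finset ℕ) (k : ℕ) : Prop :=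
  ∃ w : ℕ → ZMod 2, w k ≠ 0 ∧
    (∀ j < n, j ≠ k → j ∉ A → w j = 0) ∧
    (∀ j < n, j ∉ B → parity w j = 0)

/-- Probability that a set of independently erased positions, each erased with probability `p`,
among `n` positions equals `A`. -/
noncomputable def erasureWeight (n : ℕ) (p : ℝ) (A : Finset ℕ) : ℝ :=
  p ^ A.card * (1 - p) ^ (n - A.card)

open Classical in
/-- Probability that the extrinsic decoder output for the information bit `k` is an erasure, when
information bits are erased with probability `x` and parity bits with probability `y`. -/
noncomputable def extrinsicErasureProb (n : ℕ) (x y : ℝ) (k : ℕ) : ℝ :=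
  ∑ A ∈ (Finset.range n).powerset, ∑ B ∈ (Finset.range n).powerset,
    if ExtrinsicErased n A B k then erasureWeight n x A * erasureWeight n y B else 0

/-- Average extrinsic erasure probability of the information bits of a block of length `n`. -/
noncomputable def avgExtrinsicErasureProb (n : ℕ) (x y : ℝ) : ℝ :=
  (∑ k ∈ Finset.range n, extrinsicErasureProb n x y k) / n

/-- The transfer function for information bits of the `(1, 1/3)` convolutional code: the limit of
the average extrinsic erasure probability as the block length tends to infinity. -/
noncomputable def infoTransfer (x y : ℝ) : ℝ :=
  limUnder atTop (fun n : ℕ => avgExtrinsicErasureProb n x y)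

/-! ### Rates -/

/-- Code rate of the mother PCC built from two rate-1/2 systematic component codes. -/
noncomputable def motherRate : ℝ := 1 / 3

/-- Code rate of the GSC-PCC with repetition factor `q`, repetition ratio `lam`, a fraction `rho`
of surviving parity bits, coupling memory `m` and coupling length `L`: per unit of component input
length, there are `L` blocks with `1 - (q-1) lam` information bits each, and `L + m` pairs of
punctured parity sequences. -/
noncomputable def codeRate (q : ℕ) (lam rho : ℝ) (m L : ℕ) : ℝ :=
  (L * (1 - (q - 1) * lam)) /
    (L * (1 - (q - 1) * lam) + (L + m) * ((1 / motherRate - 1) * rho))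

/-- The fraction of surviving parity bits for which the rate approaches `R` as `L → ∞`. -/
noncomputable def survivingFraction (R : ℝ) (q : ℕ) (lam : ℝ) : ℝ :=
  ((1 - (q - 1) * lam) * (1 - R)) / (R * (1 / motherRate - 1))

/-! ### Density evolution of the coupled ensemble on the binary erasure channel -/

/-- Average erasure probability from the factor nodes at times `t, …, t+m` to the information
node at time `t`. The information bits at times outside `1, …, L` are known zeros. -/
noncomputable def nodeAvg (m L : ℕ) (p : ℤ → ℝ) (t : ℤ) : ℝ :=
  if 1 ≤ t ∧ t ≤ L then (∑ j ∈ Finset.range (m + 1), p (t + j)) / (m + 1) else 0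

/-- Average erasure probability of the information bits at the input of a component decoder at
time `t`; `p` belongs to the decoders of the same kind (upper or lower), `p'` to the other kind. -/
noncomputable def decoderInput (q : ℕ) (lam : ℝ) (m L : ℕ) (eps : ℝ) (p p' : ℤ → ℝ) (t : ℤ) : ℝ :=
  eps / (m + 1) * ∑ k ∈ Finset.range (m + 1),
    (q * lam * nodeAvg m L p' (t - k) ^ q * nodeAvg m L p (t - k) ^ (q - 1)
      + (1 - q * lam) * nodeAvg m L p' (t - k))

/-- Density evolution: the pair of the output erasure probabilities (for information bits) of the
upper and the lower component decoders at every time, after a given number of iterations. The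
transfer functions of the upper and lower decoders are `fU` and `fL`, and the parity bits are
erased with probability `1 - (1 - eps) * rho` because of the puncturing. -/
noncomputable def densityEvolution (fU fL : ℝ → ℝ → ℝ) (q : ℕ) (lam rho : ℝ) (m L : ℕ) (eps : ℝ) :
    ℕ → (ℤ → ℝ) × (ℤ → ℝ)
  | 0 => (fun _ => 1, fun _ => 1)
  | l + 1 =>
    let P := densityEvolution fU fL q lam rho m L eps l
    (fun t => fU (decoderInput q lam m L eps P.1 P.2 t) (1 - (1 - eps) * rho),
     fun t => fL (decoderInput q lam m L eps P.2 P.1 t) (1 - (1 - eps) * rho))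

/-- BP decoding succeeds at channel erasure probability `eps`: under density evolution the average
erasure probabilities passed to all information nodes tend to zero. -/
def BPSucceeds (fU fL : ℝ → ℝ → ℝ) (q : ℕ) (lam rho : ℝ) (m L : ℕ) (eps : ℝ) : Prop :=
  ∀ t : ℤ, 1 ≤ t → t ≤ L →
    Tendsto (fun l => nodeAvg m L (densityEvolution fU fL q lam rho m L eps l).1 t) atTop (𝓝 0) ∧
    Tendsto (fun l => nodeAvg m L (densityEvolution fU fL q lam rho m L eps l).2 t) atTop (𝓝 0)

/-- The BP threshold of the GSC-PCC ensemble on the binary erasure channel. -/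
noncomputable def bpThreshold (fU fL : ℝ → ℝ → ℝ) (q : ℕ) (lam rho : ℝ) (m L : ℕ) : ℝ :=
  sSup {eps : ℝ | 0 ≤ eps ∧ eps ≤ 1 ∧ BPSucceeds fU fL q lam rho m L eps}

end GSCPCC

namespace GSCPCC

/-! ### Erasure patterns of the component code -/

/-! The component code is an accumulator, so on the erasure channel its decoder works on a path. An
information bit is the difference of two neighbouring parity values, and its extrinsic output is
known exactly when both values can be computed, one from the left and one from the right
(`extrinsicErased_iff`). The two events are independent and have explicit geometric probabilities.
Averaging over the position gives the limit `transfer` in closed form, with antiderivative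
`transferIntegral`, written G below.

For repetition ratio `1/q` and equal component codes the density evolution is a scalar recursion
with exponent `d = 2q - 1` (`densityEvolution_eq`). The uncoupled recursion has the potential V(u) =
ε d/(d+1) u^(d+1) - G(ε u^d). Both bounds on the threshold come from V, using that G and u ↦ u^(d+1)
are convex (`transfer_mul_sub_le`, `young_pow`).

Failure: the coupled potential does not increase along the iteration (`coupledPotential_succ_le`)
and starts at no more than L V(1) + m. If the decoder succeeded, its limit would be at least 0. So
V(1) < 0 excludes success for large L (`not_tendsto_of_potential_neg`).

Success: the chain is dominated by the half-infinite one on times ≥ 1, whose iterates are monotone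
in time and converge to a monotone fixed point. Summation by parts along this profile gives V ≤
1/(m+1) at its limit at infinity (`fixedPoint_potential_le`). Nonzero fixed points of the uncoupled
recursion have V bounded below by a positive constant (`potential_ge`, `fixedPoint_pow_ge`), so for
large m the profile vanishes.

With the prescribed puncturing, 1 - y = (1-ε)(1-R)/(2qR). Then V(1) < 0 as soon as ε > 1-R, and the
positivity condition for success becomes ε < (1-1/(2q))²(1-ε)(1-R)/R, which tends to ε < 1-R as q →
∞. -/

open Classical in
/-- Probability of a property of the erasure patterns of the information and parity bits. -/
noncomputable def patternProb (n : ℕ) (x y : ℝ) (φ : Finset ℕ → Finset ℕ → Prop) : ℝ :=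
  ∑ A ∈ (Finset.range n).powerset, ∑ B ∈ (Finset.range n).powerset,
    if φ A B then erasureWeight n x A * erasureWeight n y B else 0

theorem sum_erasureWeight_succ (n : ℕ) (p : ℝ) (h : Finset ℕ → ℝ) :
    ∑ A ∈ (Finset.range (n + 1)).powerset, h A * erasureWeight (n + 1) p A =
      (1 - p) * ∑ A ∈ (Finset.range n).powerset, h A * erasureWeight n p A +
        p * ∑ A ∈ (Finset.range n).powerset, h (insert n A) * erasureWeight n p A := by
  rw [Finset.range_add_one, Finset.sum_powerset_insert (by simp), Finset.mul_sum, Finset.mul_sum]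
  congr 1
  · refine Finset.sum_congr rfl fun A hA => ?_
    have hc : A.card ≤ n := by simpa using Finset.card_le_card (Finset.mem_powerset.1 hA)
    rw [erasureWeight, erasureWeight, Nat.succ_sub hc, pow_succ]
    ring
  · refine Finset.sum_congr rfl fun A hA => ?_
    have hn : n ∉ A := fun h => by simpa using Finset.mem_powerset.1 hA h
    rw [erasureWeight, erasureWeight, Finset.card_insert_of_notMem hn, Nat.add_sub_add_right,
      pow_succ]
    ring

/-- Conditioning on the erasures at the last position `n`. All pattern probabilities below are
computed by this recursion. -/
theorem patternProb_succ (n : ℕ) (x y : ℝ) (φ : Finset ℕ → Finset ℕ → Prop) :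
    patternProb (n + 1) x y φ =
      (1 - x) * (1 - y) * patternProb n x y φ +
      (1 - x) * y * patternProb n x y (fun A B => φ A (insert n B)) +
      x * (1 - y) * patternProb n x y (fun A B => φ (insert n A) B) +
      x * y * patternProb n x y (fun A B => φ (insert n A) (insert n B)) := by
  classical
  have key : ∀ (k : ℕ) (ψ : Finset ℕ → Finset ℕ → Prop), patternProb k x y ψ =
      ∑ A ∈ (Finset.range k).powerset, (∑ B ∈ (Finset.range k).powerset,
        (if ψ A B then 1 else 0) * erasureWeight k y B) * erasureWeight k x A := by
    intro k ψ
    unfold patternProb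
    refine Finset.sum_congr rfl fun A _ => ?_
    rw [Finset.sum_mul]
    refine Finset.sum_congr rfl fun B _ => ?_
    split_ifs <;> ring
  simp only [key]
  rw [sum_erasureWeight_succ]
  simp only [sum_erasureWeight_succ, add_mul, Finset.sum_add_distrib, mul_assoc, ← Finset.mul_sum]
  ring

theorem patternProb_congr {n : ℕ} {x y : ℝ} {φ ψ : Finset ℕ → Finset ℕ → Prop}
    (h : ∀ A B, A ⊆ Finset.range n → B ⊆ Finset.range n → (φ A B ↔ ψ A B)) :
    patternProb n x y φ = patternProb n x y ψ := by
  classical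
  refine Finset.sum_congr rfl fun A hA => Finset.sum_congr rfl fun B hB => ?_
  rw [if_congr (h A B (Finset.mem_powerset.1 hA) (Finset.mem_powerset.1 hB)) rfl rfl]

theorem patternProb_or {n : ℕ} {x y : ℝ} {φ ψ : Finset ℕ → Finset ℕ → Prop}
    (h : ∀ A B, φ A B → ¬ ψ A B) :
    patternProb n x y (fun A B => φ A B ∨ ψ A B) = patternProb n x y φ + patternProb n x y ψ := by
  classical
  simp only [patternProb, ← Finset.sum_add_distrib]
  refine Finset.sum_congr rfl fun A _ => Finset.sum_congr rfl fun B _ => ?_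
  have := h A B
  by_cases h1 : φ A B <;> by_cases h2 : ψ A B <;> simp_all

theorem patternProb_true (n : ℕ) (x y : ℝ) : patternProb n x y (fun _ _ => True) = 1 := by
  induction n with
  | zero => simp [patternProb, erasureWeight]
  | succ n ih => rw [patternProb_succ]; simp only [ih]; ring

theorem patternProb_false (n : ℕ) (x y : ℝ) : patternProb n x y (fun _ _ => False) = 0 := by
  simp [patternProb]

/-- An erased information bit before `k` is followed by erased parity bits up to `k - 1`. -/
def LeftOpen (k : ℕ) (A B : Finset ℕ) : Prop :=
  ∃ r < k, r ∈ A ∧ ∀ j, r ≤ j → j < k → j ∈ B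

/-- A known parity bit at or after `k` is reached from `k` through known information bits. -/
def RightClosed (k n : ℕ) (A B : Finset ℕ) : Prop :=
  ∃ r, k ≤ r ∧ r < n ∧ r ∉ B ∧ ∀ j, k < j → j ≤ r → j ∉ A

/-- All parity bits in `[k, n)` are erased and all information bits in `(k, n)` are known. -/
def RightUndecided (k n : ℕ) (A B : Finset ℕ) : Prop :=
  ∀ j, k ≤ j → j < n → j ∈ B ∧ (k < j → j ∉ A)

/-- The forward recursion of the decoder: parity value `k` stays unknown from the left when it is
erased and cannot be obtained from its predecessor and information bit `k`. -/
theorem leftOpen_succ {k : ℕ} {A B : Finset ℕ} :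
    LeftOpen (k + 1) A B ↔ k ∈ B ∧ (k ∈ A ∨ LeftOpen k A B) := by
  constructor
  · rintro ⟨r, hr, hA, hB⟩
    refine ⟨hB k (by omega) (by omega), ?_⟩
    rcases Nat.lt_succ_iff_lt_or_eq.1 hr with h | h
    · exact Or.inr ⟨r, h, hA, fun j h1 h2 => hB j h1 (by omega)⟩
    · exact Or.inl (h ▸ hA)
  · rintro ⟨hk, h | ⟨r, hr, hA, hB⟩⟩
    · refine ⟨k, by omega, h, fun j h1 h2 => ?_⟩
      obtain rfl : j = k := by omega
      exact hk
    · refine ⟨r, by omega, hA, fun j h1 h2 => ?_⟩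
      rcases Nat.lt_succ_iff_lt_or_eq.1 h2 with h | h
      · exact hB j h1 h
      · exact h ▸ hk

theorem leftOpen_insert_left {k n : ℕ} (h : k ≤ n) {A B : Finset ℕ} :
    LeftOpen k (insert n A) B ↔ LeftOpen k A B := by
  unfold LeftOpen
  refine exists_congr fun r => and_congr_right fun hr => ?_
  rw [Finset.mem_insert, or_iff_right (by omega : r ≠ n)]

theorem leftOpen_insert_right {k n : ℕ} (h : k ≤ n) {A B : Finset ℕ} :
    LeftOpen k A (insert n B) ↔ LeftOpen k A B := by
  unfold LeftOpen
  refine exists_congr fun r => and_congr_right fun hr => and_congr_right fun _ =>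
    forall_congr' fun j => forall_congr' fun _ => forall_congr' fun hj => ?_
  rw [Finset.mem_insert, or_iff_right (by omega : j ≠ n)]

theorem rightClosed_insert_left {k n : ℕ} {A B : Finset ℕ} :
    RightClosed k n (insert n A) B ↔ RightClosed k n A B := by
  unfold RightClosed
  refine exists_congr fun r => and_congr_right fun _ => and_congr_right fun hr =>
    and_congr_right fun _ => forall_congr' fun j => forall_congr' fun _ => forall_congr' fun hj => ?_
  rw [Finset.mem_insert, or_iff_right (by omega : j ≠ n)]

theorem rightClosed_insert_right {k n : ℕ} {A B : Finset ℕ} :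
    RightClosed k n A (insert n B) ↔ RightClosed k n A B := by
  unfold RightClosed
  refine exists_congr fun r => and_congr_right fun _ => and_congr_right fun hr => ?_
  rw [Finset.mem_insert, or_iff_right (by omega : r ≠ n)]

theorem rightUndecided_insert_left {k n : ℕ} {A B : Finset ℕ} :
    RightUndecided k n (insert n A) B ↔ RightUndecided k n A B := by
  unfold RightUndecided
  refine forall_congr' fun j => forall_congr' fun _ => forall_congr' fun hj => ?_
  rw [Finset.mem_insert, or_iff_right (by omega : j ≠ n)]

theorem rightUndecided_insert_right {k n : ℕ} {A B : Finset ℕ} :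
    RightUndecided k n A (insert n B) ↔ RightUndecided k n A B := by
  unfold RightUndecided
  refine forall_congr' fun j => forall_congr' fun _ => forall_congr' fun hj => ?_
  rw [Finset.mem_insert, or_iff_right (by omega : j ≠ n)]

theorem rightUndecided_succ {k n : ℕ} (h : k < n) {A B : Finset ℕ} :
    RightUndecided k (n + 1) A B ↔ RightUndecided k n A B ∧ n ∈ B ∧ n ∉ A := by
  constructor
  · exact fun H => ⟨fun j h1 h2 => H j h1 (by omega), (H n h.le (by omega)).1,
      (H n h.le (by omega)).2 h⟩
  · rintro ⟨H, hB, hA⟩ j h1 h2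
    rcases Nat.lt_succ_iff_lt_or_eq.1 h2 with h' | rfl
    · exact H j h1 h'
    · exact ⟨hB, fun _ => hA⟩

theorem RightClosed.not_rightUndecided {k n : ℕ} {A B : Finset ℕ} (h : RightClosed k n A B) :
    ¬ RightUndecided k n A B := by
  obtain ⟨r, h1, h2, h3, -⟩ := h
  exact fun H => h3 (H r h1 h2).1

/-- Position `n` matters only while the search to the right of `k` is undecided: it has met neither
a known parity bit (success) nor an erased information bit (failure). -/
theorem rightClosed_succ {k n : ℕ} (h : k < n) {A B : Finset ℕ} :
    RightClosed k (n + 1) A B ↔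
      RightClosed k n A B ∨ (RightUndecided k n A B ∧ n ∉ B ∧ n ∉ A) := by
  constructor
  · rintro ⟨r, h1, h2, h3, h4⟩
    by_cases hc : RightClosed k n A B
    · exact Or.inl hc
    · have hr : r = n := by
        by_contra hne
        exact hc ⟨r, h1, by omega, h3, h4⟩
      subst hr
      refine Or.inr ⟨fun j hj1 hj2 => ⟨?_, fun hj => h4 j hj hj2.le⟩, h3, h4 r h le_rfl⟩
      by_contra hB
      exact hc ⟨j, hj1, hj2, hB, fun i hi1 hi2 => h4 i hi1 (by omega)⟩
  · rintro (⟨r, h1, h2, h3, h4⟩ | ⟨H, hB, hA⟩)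
    · exact ⟨r, h1, by omega, h3, h4⟩
    · refine ⟨n, h.le, by omega, hB, fun j hj1 hj2 => ?_⟩
      rcases hj2.lt_or_eq with h' | rfl
      · exact (H j hj1.le h').2 hj1
      · exact hA

theorem parity_eq_sum (w : ℕ → ZMod 2) (k : ℕ) :
    parity w k = ∑ i ∈ Finset.range (k + 1), w i := by
  induction k with
  | zero => simp [parity]
  | succ k ih => rw [parity, ih, Finset.sum_range_succ _ (k + 1)]

/-- The information sequence whose parity sequence is `v`. -/
def infoOfParity (v : ℕ → ZMod 2) : ℕ → ZMod 2
  | 0 => v 0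
  | k + 1 => v (k + 1) - v k

theorem parity_infoOfParity (v : ℕ → ZMod 2) (k : ℕ) : parity (infoOfParity v) k = v k := by
  induction k with
  | zero => simp [parity, infoOfParity]
  | succ k ih => rw [parity, ih, infoOfParity]; ring

/-- The codeword whose parity is the indicator of `[r, k)` has information bits supported at `r` and
`k` only. -/
theorem extrinsicErased_of_leftOpen {n k : ℕ} {A B : Finset ℕ} (h : LeftOpen k A B) :
    ExtrinsicErased n A B k := by
  obtain ⟨r, hr, hA, hB⟩ := h
  refine ⟨infoOfParity fun j => if r ≤ j ∧ j < k then 1 else 0, ?_, ?_, ?_⟩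
  · obtain ⟨k, rfl⟩ := Nat.exists_eq_succ_of_ne_zero (by omega : k ≠ 0)
    simp [infoOfParity, show r ≤ k by omega]
  · rintro (_ | j) _ hjk hjA
    · have : r ≠ 0 := by rintro rfl; exact hjA hA
      simp [infoOfParity, this]
    · have : r ≠ j + 1 := by rintro rfl; exact hjA hA
      have h1 : (r ≤ j + 1 ∧ j + 1 < k) ↔ (r ≤ j ∧ j < k) := by omega
      simp only [infoOfParity, h1, sub_self]
  · intro j _ hj
    rw [parity_infoOfParity, if_neg]
    exact fun h => hj (hB j h.1 h.2)

theorem extrinsicErased_of_not_rightClosed {n k : ℕ} (hk : k < n) {A B : Finset ℕ}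
    (h : ¬ RightClosed k n A B) : ExtrinsicErased n A B k := by
  classical
  have h : ∀ r, k ≤ r → r < n → r ∉ B → ∃ j, k < j ∧ j ≤ r ∧ j ∈ A := by
    intro r h1 h2 h3
    by_contra! H
    exact h ⟨r, h1, h2, h3, H⟩
  -- Here `s` is the first erased information position after `k`, or the end `n` of the block if
  -- there is none. The trellis is not terminated, so a parity run reaching the end needs no closing
  -- information bit inside the block.
  obtain ⟨s, hks, hsn, hs, hB⟩ : ∃ s, k < s ∧ s ≤ n ∧ (s < n → s ∈ A) ∧
      ∀ j, k ≤ j → j < s → j ∈ B := by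
    by_cases hex : ∃ s, k < s ∧ s < n ∧ s ∈ A
    · refine ⟨Nat.find hex, (Nat.find_spec hex).1, (Nat.find_spec hex).2.1.le,
        fun _ => (Nat.find_spec hex).2.2, fun j h1 h2 => ?_⟩
      by_contra hj
      obtain ⟨i, hi1, hi2, hi3⟩ := h j h1 (h2.trans (Nat.find_spec hex).2.1) hj
      exact Nat.find_min hex (lt_of_le_of_lt hi2 h2)
        ⟨hi1, by have := (Nat.find_spec hex).2.1; omega, hi3⟩
    · refine ⟨n, hk, le_rfl, fun h => absurd h (lt_irrefl n), fun j h1 h2 => ?_⟩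
      by_contra hj
      obtain ⟨i, hi1, hi2, hi3⟩ := h j h1 h2 hj
      exact hex ⟨i, hi1, by omega, hi3⟩
  refine ⟨infoOfParity fun j => if k ≤ j ∧ j < s then 1 else 0, ?_, ?_, ?_⟩
  · rcases k with _ | k
    · simp [infoOfParity, hks]
    · simp [infoOfParity, hks]
  · rintro (_ | j) hjn hjk hjA
    · have : k ≠ 0 := fun h => hjk h.symm
      simp [infoOfParity, this]
    · have : s ≠ j + 1 := by rintro rfl; exact hjA (hs hjn)
      have h1 : (k ≤ j + 1 ∧ j + 1 < s) ↔ (k ≤ j ∧ j < s) := by omega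
      simp only [infoOfParity, h1, sub_self]
  · intro j _ hj
    rw [parity_infoOfParity, if_neg]
    exact fun h => hj (hB j h.1 h.2)

theorem extrinsicErased_iff {n k : ℕ} (hk : k < n) {A B : Finset ℕ} :
    ExtrinsicErased n A B k ↔ ¬ (¬ LeftOpen k A B ∧ RightClosed k n A B) := by
  constructor
  · rintro ⟨w, hw, hA, hB⟩ ⟨hL, r, hr1, hr2, hr3, hr4⟩
    simp only [parity_eq_sum] at hB
    -- The partial sums of `w` are the parity values. They vanish just before `k` by the left
    -- condition and at `k` by the right one, which forces `w k = 0`.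
    have left : ∀ j ≤ k, ¬ LeftOpen j A B → ∑ i ∈ Finset.range j, w i = 0 := by
      intro j
      induction j with
      | zero => simp
      | succ j ih =>
        intro hj hL
        rw [leftOpen_succ, not_and_or, not_or] at hL
        rcases hL with hL | ⟨h1, h2⟩
        · exact hB j (by omega) hL
        · rw [Finset.sum_range_succ, ih (by omega) h2, hA j (by omega) (by omega) h1, add_zero]
    have right : ∀ j, k ≤ j → j ≤ r →
        ∑ i ∈ Finset.range (j + 1), w i = ∑ i ∈ Finset.range (k + 1), w i := by
      intro j hj
      induction j, hj using Nat.le_induction with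
      | base => simp
      | succ j hj ih =>
        intro h
        rw [Finset.sum_range_succ, ih (by omega),
          hA (j + 1) (by omega) (by omega) (hr4 _ (by omega) h), add_zero]
    have h1 := left k le_rfl hL
    have h2 := right r hr1 le_rfl
    rw [hB r hr2 hr3, Finset.sum_range_succ, h1, zero_add] at h2
    exact hw h2.symm
  · intro h
    rw [not_and_or, not_not] at h
    rcases h with h | h
    · exact extrinsicErased_of_leftOpen h
    · exact extrinsicErased_of_not_rightClosed hk h

/-! ### The transfer function -/

/-- By `leftOpen_succ` the probability satisfies P(k+1) = (1-y) + (1-x) y P(k) with P(0) = 1, the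
initial state being known. -/
theorem patternProb_not_leftOpen (x y : ℝ) (k : ℕ) :
    patternProb k x y (fun A B => ¬ LeftOpen k A B) =
      (1 - y) * ∑ j ∈ Finset.range k, ((1 - x) * y) ^ j + ((1 - x) * y) ^ k := by
  induction k with
  | zero =>
    rw [patternProb_congr (ψ := fun _ _ => True) (by simp [LeftOpen]), patternProb_true]
    simp
  | succ k ih =>
    have hk : ∀ {A : Finset ℕ}, A ⊆ Finset.range k → k ∉ A := fun hA h => by simpa using hA h
    rw [patternProb_succ,
      patternProb_congr (ψ := fun _ _ => True)
        (fun A B hA hB => by simp [leftOpen_succ, hk hA, hk hB]),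
      patternProb_congr (φ := fun A B => ¬ LeftOpen (k + 1) A (insert k B))
        (ψ := fun A B => ¬ LeftOpen k A B)
        (fun A B hA hB => by simp [leftOpen_succ, leftOpen_insert_right, hk hA]),
      patternProb_congr (φ := fun A B => ¬ LeftOpen (k + 1) (insert k A) B)
        (ψ := fun _ _ => True)
        (fun A B hA hB => by simp [leftOpen_succ, hk hB]),
      patternProb_congr (φ := fun A B => ¬ LeftOpen (k + 1) (insert k A) (insert k B))
        (ψ := fun _ _ => False)
        (fun A B hA hB => by simp [leftOpen_succ]),
      ih, patternProb_true, patternProb_false, Finset.sum_range_succ', pow_succ]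
    simp only [pow_succ, ← Finset.sum_mul]
    ring

/-- The left event concerns positions before `k` and the right events those from `k` on, hence the
product form. The undecided event is carried along because it feeds the recursion for the closed
one. -/
theorem patternProb_right (x y : ℝ) (k i : ℕ) :
    patternProb (k + 1 + i) x y (fun A B => ¬ LeftOpen k A B ∧ RightUndecided k (k + 1 + i) A B) =
        patternProb k x y (fun A B => ¬ LeftOpen k A B) * (y * ((1 - x) * y) ^ i) ∧
    patternProb (k + 1 + i) x y (fun A B => ¬ LeftOpen k A B ∧ RightClosed k (k + 1 + i) A B) =
        patternProb k x y (fun A B => ¬ LeftOpen k A B) *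
          ((1 - y) * ∑ j ∈ Finset.range (i + 1), ((1 - x) * y) ^ j) := by
  induction i with
  | zero =>
    have hk : ∀ {A : Finset ℕ}, A ⊆ Finset.range k → k ∉ A := fun hA h => by simpa using hA h
    have hU : ∀ A B, RightUndecided k (k + 1) A B ↔ k ∈ B := fun A B =>
      ⟨fun h => (h k le_rfl (by omega)).1, fun h j h1 h2 => by
        obtain rfl : j = k := by omega
        exact ⟨h, fun h => absurd h (lt_irrefl _)⟩⟩
    have hC : ∀ A B, RightClosed k (k + 1) A B ↔ k ∉ B := fun A B =>
      ⟨fun ⟨r, h1, h2, h3, _⟩ => by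
        obtain rfl : r = k := by omega
        exact h3, fun h => ⟨k, le_rfl, by omega, h, fun j h1 h2 => by omega⟩⟩
    simp only [add_zero, hU, hC, patternProb_succ, Finset.mem_insert_self, and_true,
      leftOpen_insert_left le_rfl, leftOpen_insert_right le_rfl, not_true_eq_false, and_false,
      patternProb_false]
    have e1 : patternProb k x y (fun A B => ¬ LeftOpen k A B ∧ k ∈ B) = 0 := by
      rw [patternProb_congr (ψ := fun _ _ => False) (fun A B hA hB => by simp [hk hB]),
        patternProb_false]
    have e2 : patternProb k x y (fun A B => ¬ LeftOpen k A B ∧ k ∉ B) =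
        patternProb k x y (fun A B => ¬ LeftOpen k A B) :=
      patternProb_congr (fun A B hA hB => by simp [hk hB])
    rw [e1, e2]
    constructor
    · ring
    · simp; ring
  | succ i ih =>
    obtain ⟨ih1, ih2⟩ := ih
    rw [← add_assoc]
    generalize hn : k + 1 + i = n at *
    have hkn : k < n := by omega
    have hk : ∀ {A : Finset ℕ}, A ⊆ Finset.range n → n ∉ A := fun hA h => by simpa using hA h
    constructor
    · rw [patternProb_succ]
      simp only [rightUndecided_succ hkn, leftOpen_insert_left hkn.le,
        leftOpen_insert_right hkn.le, rightUndecided_insert_left, rightUndecided_insert_right,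
        Finset.mem_insert_self, not_true_eq_false, and_false, true_and, patternProb_false]
      rw [patternProb_congr
          (φ := fun A B => ¬ LeftOpen k A B ∧ RightUndecided k n A B ∧ n ∈ B ∧ n ∉ A)
          (ψ := fun _ _ => False) (fun A B hA hB => by simp [hk hB]),
        patternProb_congr (φ := fun A B => ¬ LeftOpen k A B ∧ RightUndecided k n A B ∧ n ∉ A)
          (ψ := fun A B => ¬ LeftOpen k A B ∧ RightUndecided k n A B)
          (fun A B hA hB => by simp [hk hA]), patternProb_false, ih1]
      ring
    · rw [patternProb_succ]
      simp only [rightClosed_succ hkn, leftOpen_insert_left hkn.le,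
        leftOpen_insert_right hkn.le, rightUndecided_insert_left, rightUndecided_insert_right,
        rightClosed_insert_left, rightClosed_insert_right,
        Finset.mem_insert_self, not_true_eq_false, and_false, false_and, or_false]
      rw [patternProb_congr (ψ := fun A B => (¬ LeftOpen k A B ∧ RightClosed k n A B) ∨
          (¬ LeftOpen k A B ∧ RightUndecided k n A B))
          (fun A B hA hB => by simp [hk hA, hk hB, and_or_left]),
        patternProb_or (fun A B h h' => h.2.not_rightUndecided h'.2), ih1, ih2,
        Finset.sum_range_succ _ (i + 1)]
      ring

theorem extrinsicErasureProb_eq (x y : ℝ) {n k : ℕ} (hk : k < n) :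
    extrinsicErasureProb n x y k =
      1 - ((1 - y) * ∑ j ∈ Finset.range k, ((1 - x) * y) ^ j + ((1 - x) * y) ^ k) *
        ((1 - y) * ∑ j ∈ Finset.range (n - 1 - k + 1), ((1 - x) * y) ^ j) := by
  have h1 : extrinsicErasureProb n x y k =
      patternProb n x y (fun A B => ¬ (¬ LeftOpen k A B ∧ RightClosed k n A B)) := by
    change patternProb n x y (fun A B => ExtrinsicErased n A B k) = _
    exact patternProb_congr fun A B _ _ => extrinsicErased_iff hk
  have h2 := patternProb_or (n := n) (x := x) (y := y)
    (φ := fun A B => ¬ (¬ LeftOpen k A B ∧ RightClosed k n A B))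
    (ψ := fun A B => ¬ LeftOpen k A B ∧ RightClosed k n A B) (fun _ _ h => h)
  rw [patternProb_congr (ψ := fun _ _ => True) (fun A B _ _ => by
    simp only [iff_true]; exact (em _).symm), patternProb_true] at h2
  have h3 := (patternProb_right x y k (n - 1 - k)).2
  rw [show k + 1 + (n - 1 - k) = n by omega, patternProb_not_leftOpen] at h3
  rw [h1, ← h3]
  linarith

/-- The deviation of each product from `a ^ 2` is at most the sum of the deviations of its factors,
and each of these has Cesàro mean tending to 0; reversing the order of summation handles the index
`n - 1 - k`. -/
theorem tendsto_convolution_average {c d : ℕ → ℝ} {a : ℝ} (ha : |a| ≤ 1) (hd : ∀ i, |d i| ≤ 1)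
    (hc : Tendsto c atTop (𝓝 a)) (hd' : Tendsto d atTop (𝓝 a)) :
    Tendsto (fun n : ℕ => (∑ k ∈ Finset.range n, (1 - c k * d (n - 1 - k))) / n) atTop
      (𝓝 (1 - a ^ 2)) := by
  have ces : ∀ {e : ℕ → ℝ}, Tendsto e atTop (𝓝 a) →
      Tendsto (fun n : ℕ => (n⁻¹ : ℝ) * ∑ k ∈ Finset.range n, |e k - a|) atTop (𝓝 0) := by
    intro e he
    have : Tendsto (fun n => |e n - a|) atTop (𝓝 0) := by
      simpa using (he.sub_const a).abs
    exact this.cesaro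
  have hsum := (ces hc).add (ces hd')
  rw [add_zero] at hsum
  rw [tendsto_iff_norm_sub_tendsto_zero]
  refine squeeze_zero' (Eventually.of_forall fun _ => norm_nonneg _) ?_ hsum
  filter_upwards [eventually_gt_atTop 0] with n hn
  have hn' : (0 : ℝ) < n := by exact_mod_cast hn
  have e1 : (∑ k ∈ Finset.range n, (1 - c k * d (n - 1 - k))) / n - (1 - a ^ 2) =
      (n⁻¹ : ℝ) * ∑ k ∈ Finset.range n, (a ^ 2 - c k * d (n - 1 - k)) := by
    simp only [Finset.sum_sub_distrib, Finset.sum_const, Finset.card_range, nsmul_eq_mul]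
    field_simp
    ring
  rw [e1, ← mul_add, norm_mul, Real.norm_eq_abs, abs_of_pos (inv_pos.2 hn'),
    ← Finset.sum_range_reflect (fun k => |d k - a|), ← Finset.sum_add_distrib]
  refine mul_le_mul_of_nonneg_left ((norm_sum_le _ _).trans (Finset.sum_le_sum fun k _ => ?_))
    (inv_pos.2 hn').le
  rw [Real.norm_eq_abs, show a ^ 2 - c k * d (n - 1 - k) =
    -((c k - a) * d (n - 1 - k) + a * (d (n - 1 - k) - a)) by ring, abs_neg]
  refine (abs_add_le _ _).trans (add_le_add ?_ ?_)
  · rw [abs_mul]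
    exact mul_le_of_le_one_right (abs_nonneg _) (hd _)
  · rw [abs_mul]
    exact mul_le_of_le_one_left (abs_nonneg _) ha

/-- Closed form of the transfer function for information bits of the `(1, 1/3)` code. -/
noncomputable def transfer (x y : ℝ) : ℝ := 1 - ((1 - y) / (1 - y + x * y)) ^ 2

theorem tendsto_avgExtrinsicErasureProb {x y : ℝ} (hx : x ∈ Set.Icc (0 : ℝ) 1)
    (hy : y ∈ Set.Icc (0 : ℝ) 1) :
    Tendsto (fun n : ℕ => avgExtrinsicErasureProb n x y) atTop (𝓝 (transfer x y)) := by
  obtain ⟨hx0, hx1⟩ := hx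
  obtain ⟨hy0, hy1⟩ := hy
  set z := (1 - x) * y with hz
  have hz0 : 0 ≤ z := mul_nonneg (by linarith) hy0
  have hden : 1 - y + x * y = 1 - z := by rw [hz]; ring
  have hz1 : z ≤ 1 := by nlinarith
  have heq : ∀ n : ℕ, avgExtrinsicErasureProb n x y =
      (∑ k ∈ Finset.range n, (1 - ((1 - y) * ∑ j ∈ Finset.range k, z ^ j + z ^ k) *
        ((1 - y) * ∑ j ∈ Finset.range (n - 1 - k + 1), z ^ j))) / n := by
    intro n
    rw [avgExtrinsicErasureProb]
    congr 1
    exact Finset.sum_congr rfl fun k hk => extrinsicErasureProb_eq x y (Finset.mem_range.1 hk)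
  simp only [heq, transfer, hden]
  rcases hz1.lt_or_eq with hlt | h1
  · have hgeo : Tendsto (fun n => (1 - y) * ∑ j ∈ Finset.range n, z ^ j) atTop
        (𝓝 ((1 - y) / (1 - z))) :=
      ((hasSum_geometric_of_lt_one hz0 hlt).tendsto_sum_nat).const_mul (1 - y)
    have hle : 1 - y ≤ 1 - z := by nlinarith
    have ha : (1 - y) / (1 - z) ≤ 1 := (div_le_one (by linarith)).2 hle
    have ha0 : 0 ≤ (1 - y) / (1 - z) := div_nonneg (by linarith) (by linarith)
    refine tendsto_convolution_average
      (c := fun k => (1 - y) * ∑ j ∈ Finset.range k, z ^ j + z ^ k)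
      (d := fun k => (1 - y) * ∑ j ∈ Finset.range (k + 1), z ^ j)
      (by rwa [abs_of_nonneg ha0]) (fun i => ?_) ?_ (hgeo.comp (tendsto_add_atTop_nat 1))
    · have hnn : 0 ≤ ∑ j ∈ Finset.range (i + 1), z ^ j :=
        Finset.sum_nonneg fun j _ => pow_nonneg hz0 j
      rw [abs_of_nonneg (mul_nonneg (by linarith) hnn)]
      have h2 := mul_neg_geom_sum z (i + 1)
      have h3 := pow_nonneg hz0 (i + 1)
      have h4 := mul_le_mul_of_nonneg_right hle hnn
      linarith
    · simpa using hgeo.add (tendsto_pow_atTop_nhds_zero_of_lt_one hz0 hlt)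
  -- The corner x = 0, y = 1. The convention `0 / 0 = 0` makes `transfer` equal to 1 there, which is
  -- correct since no parity bit is known.
  · have hy : y = 1 := by nlinarith
    simp only [hy, sub_self, zero_mul, mul_zero, sub_zero, zero_div]
    refine tendsto_const_nhds.congr' ?_
    filter_upwards [eventually_gt_atTop 0] with n hn
    have hn' : (n : ℝ) ≠ 0 := by exact_mod_cast hn.ne'
    simp [hn']

theorem infoTransfer_eq {x y : ℝ} (hx : x ∈ Set.Icc (0 : ℝ) 1) (hy : y ∈ Set.Icc (0 : ℝ) 1) :
    infoTransfer x y = transfer x y :=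
  (tendsto_avgExtrinsicErasureProb hx hy).limUnder_eq

theorem transfer_mem {x y : ℝ} (hx : 0 ≤ x) (hy : y ∈ Set.Icc (0 : ℝ) 1) :
    transfer x y ∈ Set.Icc (0 : ℝ) 1 := by
  have hb : 0 ≤ 1 - y := by linarith [hy.2]
  have hxy : 0 ≤ x * y := mul_nonneg hx hy.1
  have h0 : 0 ≤ (1 - y) / (1 - y + x * y) := div_nonneg hb (by linarith)
  have h1 : (1 - y) / (1 - y + x * y) ≤ 1 := div_le_one_of_le₀ (by linarith) (by linarith)
  unfold transfer
  constructor <;> nlinarith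

theorem transfer_mono {x x' y : ℝ} (hx : 0 ≤ x) (hxx : x ≤ x') (hy : y ∈ Set.Icc (0 : ℝ) 1) :
    transfer x y ≤ transfer x' y := by
  have hb : 0 ≤ 1 - y := by linarith [hy.2]
  have hxy : 0 ≤ x * y := mul_nonneg hx hy.1
  have hxx' : x * y ≤ x' * y := mul_le_mul_of_nonneg_right hxx hy.1
  unfold transfer
  rcases hb.eq_or_lt with h | h
  · simp [← h]
  · have h0 : 0 ≤ (1 - y) / (1 - y + x' * y) := div_nonneg hb (by linarith)
    have h1 : (1 - y) / (1 - y + x' * y) ≤ (1 - y) / (1 - y + x * y) :=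
      div_le_div_of_nonneg_left hb (by linarith) (by linarith)
    nlinarith

theorem continuousAt_transfer {x y : ℝ} (hx : 0 ≤ x) (hy0 : 0 ≤ y) (hy1 : y < 1) :
    ContinuousAt (fun x => transfer x y) x := by
  have : 1 - y + x * y ≠ 0 := by nlinarith [mul_nonneg hx hy0]
  unfold transfer
  fun_prop (disch := assumption)

/-- The integral of the transfer function over the erasure probability of the information bits. -/
noncomputable def transferIntegral (x y : ℝ) : ℝ := x ^ 2 * y / (1 - y + x * y)

theorem transferIntegral_nonneg {x y : ℝ} (hx : 0 ≤ x) (hy : y ∈ Set.Icc (0 : ℝ) 1) :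
    0 ≤ transferIntegral x y := by
  have := mul_nonneg hx hy.1
  exact div_nonneg (mul_nonneg (sq_nonneg _) hy.1) (by linarith [hy.2])

theorem transferIntegral_le {x y : ℝ} (hx : 0 ≤ x) (hy : y ∈ Set.Icc (0 : ℝ) 1) :
    transferIntegral x y ≤ x := by
  have h := mul_nonneg hx hy.1
  refine div_le_of_le_mul₀ (by linarith [hy.2]) hx ?_
  have := mul_nonneg hx (sub_nonneg.2 hy.2)
  nlinarith

theorem continuousAt_transferIntegral {x y : ℝ} (hx : 0 ≤ x) (hy0 : 0 ≤ y) (hy1 : y < 1) :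
    ContinuousAt (fun x => transferIntegral x y) x := by
  have : 1 - y + x * y ≠ 0 := by nlinarith [mul_nonneg hx hy0]
  unfold transferIntegral
  fun_prop (disch := assumption)

/-- The integral of the transfer function lies above its tangents. -/
theorem transfer_mul_sub_le {x x' y : ℝ} (hx : 0 ≤ x) (hx' : 0 ≤ x') (hy : y ∈ Set.Icc (0 : ℝ) 1) :
    transfer x y * (x' - x) ≤ transferIntegral x' y - transferIntegral x y := by
  obtain ⟨hy0, hy1⟩ := hy
  unfold transfer transferIntegral
  rcases hy1.eq_or_lt with rfl | hy1
  -- For y = 1 the integral is the identity, also at `z = 0` where the quotient is `0 / 0`.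
  · have : ∀ z : ℝ, z ^ 2 * 1 / (1 - 1 + z * 1) = z := fun z => by simp [pow_two]
    rw [this, this]
    simp
  · have hD : 0 < 1 - y + x * y := by nlinarith [mul_nonneg hx hy0]
    have hD' : 0 < 1 - y + x' * y := by nlinarith [mul_nonneg hx' hy0]
    rw [← sub_nonneg]
    have : x' ^ 2 * y / (1 - y + x' * y) - x ^ 2 * y / (1 - y + x * y) -
        (1 - ((1 - y) / (1 - y + x * y)) ^ 2) * (x' - x) =
        (1 - y) ^ 2 * y * (x' - x) ^ 2 / ((1 - y + x * y) ^ 2 * (1 - y + x' * y)) := by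
      field_simp
      ring
    rw [this]
    positivity

/-- Young's inequality for the exponents `d + 1` and `(d + 1) / d`. -/
theorem young_pow (d : ℕ) {u v : ℝ} (hu : 0 ≤ u) (hv : 0 ≤ v) :
    (d + 1) * u ^ d * v ≤ d * u ^ (d + 1) + v ^ (d + 1) := by
  induction d with
  | zero => simp
  | succ d ih =>
    -- Multiplying the previous case by `v` leaves a gap of `(d+1) u^d (u-v)^2`.
    have h1 := mul_le_mul_of_nonneg_right ih hv
    have h2 : 0 ≤ ((d : ℝ) + 1) * u ^ d * (u - v) ^ 2 := by positivity
    push_cast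
    have e : (((d : ℝ) + 1) * u ^ (d + 1 + 1) + v ^ (d + 1 + 1)) -
        ((d : ℝ) + 1 + 1) * u ^ (d + 1) * v =
        ((d : ℝ) + 1) * u ^ d * (u - v) ^ 2 +
          ((d * u ^ (d + 1) + v ^ (d + 1)) * v - ((d : ℝ) + 1) * u ^ d * v * v) := by ring
    linarith

/-! ### The scalar form of the density evolution -/

/-- Average over the factor nodes at times `t, …, t + m`, for information nodes at times in `S`;
the information bits at other times are known. -/
noncomputable def maskAvg (m : ℕ) (S : Set ℤ) (p : ℤ → ℝ) : ℤ → ℝ :=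
  S.indicator fun t => (∑ j ∈ Finset.range (m + 1), p (t + j)) / (m + 1)

/-- Average erasure probability at the input of a component decoder when both component decoders
have the output `p`. -/
noncomputable def coupledInput (d m : ℕ) (S : Set ℤ) (eps : ℝ) (p : ℤ → ℝ) (t : ℤ) : ℝ :=
  eps / (m + 1) * ∑ k ∈ Finset.range (m + 1), maskAvg m S p (t - k) ^ d

/-- Density evolution for equal upper and lower component decoders. -/
noncomputable def coupledEvolution (d m : ℕ) (S : Set ℤ) (eps y : ℝ) : ℕ → ℤ → ℝ
  | 0 => fun _ => 1
  | l + 1 => fun t => transfer (coupledInput d m S eps (coupledEvolution d m S eps y l) t) y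

theorem nodeAvg_eq_maskAvg (m L : ℕ) : nodeAvg m L = maskAvg m (Set.Icc 1 (L : ℤ)) := by
  funext p t
  classical
  simp [nodeAvg, maskAvg, Set.indicator_apply]

section
variable {d m : ℕ} {S S' : Set ℤ} {eps y : ℝ} {p p' : ℤ → ℝ}

theorem maskAvg_of_mem {t : ℤ} (ht : t ∈ S) :
    maskAvg m S p t = (∑ j ∈ Finset.range (m + 1), p (t + j)) / (m + 1) :=
  Set.indicator_of_mem ht _

theorem maskAvg_of_notMem {t : ℤ} (ht : t ∉ S) : maskAvg m S p t = 0 :=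
  Set.indicator_of_notMem ht _

theorem maskAvg_nonneg (hp : ∀ t, 0 ≤ p t) (t : ℤ) : 0 ≤ maskAvg m S p t :=
  Set.indicator_nonneg (fun _ _ => div_nonneg (Finset.sum_nonneg fun _ _ => hp _) (by positivity)) t

theorem maskAvg_mono (hS : S ⊆ S') (hp' : ∀ t, 0 ≤ p' t) (h : ∀ t, p t ≤ p' t) (t : ℤ) :
    maskAvg m S p t ≤ maskAvg m S' p' t := by
  by_cases ht : t ∈ S
  · rw [maskAvg_of_mem ht, maskAvg_of_mem (hS ht)]
    exact div_le_div_of_nonneg_right (Finset.sum_le_sum fun _ _ => h _) (by positivity)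
  · rw [maskAvg_of_notMem ht]
    exact maskAvg_nonneg hp' t

theorem sum_range_const_div (m : ℕ) (c : ℝ) :
    (∑ _j ∈ Finset.range (m + 1), c) / (m + 1) = c := by
  rw [Finset.sum_const, Finset.card_range, nsmul_eq_mul]
  push_cast
  field_simp

theorem maskAvg_le_one (hp : ∀ t, p t ≤ 1) (t : ℤ) : maskAvg m S p t ≤ 1 := by
  refine (maskAvg_mono (p' := fun _ => 1) (Set.subset_univ S) (by simp) hp t).trans ?_
  rw [maskAvg_of_mem (Set.mem_univ t), sum_range_const_div]

theorem coupledInput_nonneg (he : 0 ≤ eps) (hp : ∀ t, 0 ≤ p t) (t : ℤ) :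
    0 ≤ coupledInput d m S eps p t :=
  mul_nonneg (div_nonneg he (by positivity))
    (Finset.sum_nonneg fun _ _ => pow_nonneg (maskAvg_nonneg hp _) _)

theorem coupledInput_mono (he : 0 ≤ eps) (hS : S ⊆ S') (hp : ∀ t, 0 ≤ p t)
    (hp' : ∀ t, 0 ≤ p' t) (h : ∀ t, p t ≤ p' t) (t : ℤ) :
    coupledInput d m S eps p t ≤ coupledInput d m S' eps p' t :=
  mul_le_mul_of_nonneg_left (Finset.sum_le_sum fun _ _ =>
    pow_le_pow_left₀ (maskAvg_nonneg hp _) (maskAvg_mono hS hp' h _) _)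
    (div_nonneg he (by positivity))

theorem coupledInput_le (he : 0 ≤ eps) (hp0 : ∀ t, 0 ≤ p t) (hp : ∀ t, p t ≤ 1) (t : ℤ) :
    coupledInput d m S eps p t ≤ eps := by
  have h : ∑ k ∈ Finset.range (m + 1), maskAvg m S p (t - k) ^ d ≤
      ∑ _k ∈ Finset.range (m + 1), (1 : ℝ) :=
    Finset.sum_le_sum fun _ _ => pow_le_one₀ (maskAvg_nonneg hp0 _) (maskAvg_le_one hp _)
  refine (mul_le_mul_of_nonneg_left h (div_nonneg he (by positivity))).trans_eq ?_
  rw [div_mul_eq_mul_div, mul_div_assoc, sum_range_const_div, mul_one]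

theorem coupledEvolution_mem (he : 0 ≤ eps) (hy : y ∈ Set.Icc (0 : ℝ) 1) (l : ℕ) :
    ∀ t, coupledEvolution d m S eps y l t ∈ Set.Icc (0 : ℝ) 1 := by
  induction l with
  | zero => intro t; simp [coupledEvolution]
  | succ l ih => exact fun t => transfer_mem (coupledInput_nonneg he (fun t => (ih t).1) t) hy

/-- Fewer known information bits can only hurt. This allows the finite chain to be compared with the
half-infinite one, which has no right boundary. -/
theorem coupledEvolution_mono (he : 0 ≤ eps) (hy : y ∈ Set.Icc (0 : ℝ) 1) (hS : S ⊆ S') (l : ℕ) :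
    ∀ t, coupledEvolution d m S eps y l t ≤ coupledEvolution d m S' eps y l t := by
  induction l with
  | zero => intro t; simp [coupledEvolution]
  | succ l ih =>
    have h0 := fun t => (coupledEvolution_mem (d := d) (m := m) (S := S) he hy l t).1
    have h0' := fun t => (coupledEvolution_mem (d := d) (m := m) (S := S') he hy l t).1
    exact fun t => transfer_mono (coupledInput_nonneg he h0 t)
      (coupledInput_mono he hS h0 h0' ih t) hy

theorem coupledEvolution_antitone (he : 0 ≤ eps) (hy : y ∈ Set.Icc (0 : ℝ) 1) (t : ℤ) :
    Antitone fun l => coupledEvolution d m S eps y l t := by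
  refine antitone_nat_of_succ_le fun l => ?_
  induction l generalizing t with
  | zero => exact (coupledEvolution_mem he hy 1 t).2
  | succ l ih =>
    have h0 := fun l t => (coupledEvolution_mem (d := d) (m := m) (S := S) he hy l t).1
    exact transfer_mono (coupledInput_nonneg he (h0 _) t)
      (coupledInput_mono he subset_rfl (h0 _) (h0 _) ih t) hy

end

/-- Since `q * (1 / q) = 1`, the unrepeated term disappears, and upper/lower symmetry merges the
powers `q` and `q - 1` into `2 * q - 1`. The closed form of the transfer function holds on the unit
square, so the decoder input has to be kept in [0, 1]. -/
theorem densityEvolution_eq {q : ℕ} (hq : 1 ≤ q) (m L : ℕ) {eps rho : ℝ}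
    (he : eps ∈ Set.Icc (0 : ℝ) 1) (hy : 1 - (1 - eps) * rho ∈ Set.Icc (0 : ℝ) 1) (l : ℕ) :
    densityEvolution infoTransfer infoTransfer q (1 / q) rho m L eps l =
      (coupledEvolution (2 * q - 1) m (Set.Icc 1 (L : ℤ)) eps (1 - (1 - eps) * rho) l,
       coupledEvolution (2 * q - 1) m (Set.Icc 1 (L : ℤ)) eps (1 - (1 - eps) * rho) l) := by
  have hq' : (q : ℝ) * (1 / q) = 1 := mul_one_div_cancel (by positivity)
  have key : ∀ p t, decoderInput q (1 / q) m L eps p p t =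
      coupledInput (2 * q - 1) m (Set.Icc 1 (L : ℤ)) eps p t := by
    intro p t
    rw [decoderInput, coupledInput, nodeAvg_eq_maskAvg, hq']
    congr 1
    refine Finset.sum_congr rfl fun k _ => ?_
    rw [one_mul, sub_self, zero_mul, add_zero, ← pow_add]
    congr 1
    omega
  induction l with
  | zero => rfl
  | succ l ih =>
    have hmem := fun t => coupledEvolution_mem (d := 2 * q - 1) (m := m)
      (S := Set.Icc 1 (L : ℤ)) he.1 hy l t
    have hstep : ∀ t, infoTransfer (coupledInput (2 * q - 1) m (Set.Icc 1 (L : ℤ)) eps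
        (coupledEvolution (2 * q - 1) m (Set.Icc 1 (L : ℤ)) eps (1 - (1 - eps) * rho) l) t)
        (1 - (1 - eps) * rho) =
        coupledEvolution (2 * q - 1) m (Set.Icc 1 (L : ℤ)) eps (1 - (1 - eps) * rho) (l + 1) t :=
      fun t => infoTransfer_eq ⟨coupledInput_nonneg he.1 (fun t => (hmem t).1) t,
        (coupledInput_le he.1 (fun t => (hmem t).1) (fun t => (hmem t).2) t).trans he.2⟩ hy
    simp only [densityEvolution, ih, key, hstep]

theorem bpSucceeds_iff {q : ℕ} (hq : 1 ≤ q) (m L : ℕ) {eps rho : ℝ}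
    (he : eps ∈ Set.Icc (0 : ℝ) 1) (hy : 1 - (1 - eps) * rho ∈ Set.Icc (0 : ℝ) 1) :
    BPSucceeds infoTransfer infoTransfer q (1 / q) rho m L eps ↔
      ∀ t ∈ Set.Icc 1 (L : ℤ), Tendsto (fun l => maskAvg m (Set.Icc 1 (L : ℤ))
        (coupledEvolution (2 * q - 1) m (Set.Icc 1 (L : ℤ)) eps (1 - (1 - eps) * rho) l) t)
        atTop (𝓝 0) := by
  simp only [BPSucceeds, densityEvolution_eq hq m L he hy, nodeAvg_eq_maskAvg, and_self,
    Set.mem_Icc, and_imp]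

/-! ### Summation by parts for the window averages -/

theorem sum_window_eq_sum (p Q : ℤ → ℝ) (M m : ℕ) :
    ∑ t ∈ Finset.Icc 1 (M : ℤ), Q t * ∑ j ∈ Finset.range (m + 1), p (t + j) =
      ∑ k ∈ Finset.range (m + 1), ∑ s ∈ Finset.Icc (1 + (k : ℤ)) (M + k), p s * Q (s - k) := by
  simp only [Finset.mul_sum]
  rw [Finset.sum_comm]
  refine Finset.sum_congr rfl fun k _ => ?_
  refine Finset.sum_nbij' (fun t => t + k) (fun s => s - k) ?_ ?_ ?_ ?_ ?_ <;>
    simp +contextual [mul_comm]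
  · intros; omega

theorem sum_window_le {p Q : ℤ → ℝ} (hp : ∀ t, 0 ≤ p t) (hQ : ∀ t, 0 ≤ Q t) (M m : ℕ) :
    ∑ t ∈ Finset.Icc 1 (M : ℤ), Q t * ∑ j ∈ Finset.range (m + 1), p (t + j) ≤
      ∑ s ∈ Finset.Icc 1 ((M + m : ℕ) : ℤ), p s * ∑ k ∈ Finset.range (m + 1), Q (s - k) := by
  rw [sum_window_eq_sum]
  simp only [Finset.mul_sum]
  rw [Finset.sum_comm (s := Finset.Icc 1 ((M + m : ℕ) : ℤ))]
  refine Finset.sum_le_sum fun k hk => ?_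
  have := Finset.mem_range.1 hk
  refine Finset.sum_le_sum_of_subset_of_nonneg
    (Finset.Icc_subset_Icc (by omega) (by push_cast; omega))
    fun s _ _ => mul_nonneg (hp _) (hQ _)

theorem sum_window_eq {p Q : ℤ → ℝ} (M m : ℕ) (hQ : ∀ t ∉ Set.Icc 1 (M : ℤ), Q t = 0) :
    ∑ t ∈ Finset.Icc 1 (M : ℤ), Q t * ∑ j ∈ Finset.range (m + 1), p (t + j) =
      ∑ s ∈ Finset.Icc 1 ((M + m : ℕ) : ℤ), p s * ∑ k ∈ Finset.range (m + 1), Q (s - k) := by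
  rw [sum_window_eq_sum]
  simp only [Finset.mul_sum]
  rw [Finset.sum_comm (s := Finset.Icc 1 ((M + m : ℕ) : ℤ))]
  refine Finset.sum_congr rfl fun k hk => ?_
  have := Finset.mem_range.1 hk
  refine Finset.sum_subset (Finset.Icc_subset_Icc (by omega) (by push_cast; omega))
    fun s _ hs => ?_
  rw [hQ, mul_zero]
  simp only [Set.mem_Icc, Finset.mem_Icc] at hs ⊢
  omega

/-! ### Failure of the decoder above the potential threshold -/

/-- Potential of the coupled system with output `p` of the component decoders. -/
noncomputable def coupledPotential (d m L : ℕ) (eps y : ℝ) (p : ℤ → ℝ) : ℝ :=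
  ∑ t ∈ Finset.Icc 1 (L : ℤ), eps * (d / (d + 1)) * maskAvg m (Set.Icc 1 (L : ℤ)) p t ^ (d + 1) -
    ∑ s ∈ Finset.Icc 1 ((L + m : ℕ) : ℤ),
      transferIntegral (coupledInput d m (Set.Icc 1 (L : ℤ)) eps p s) y

section
variable {d m L : ℕ} {eps y : ℝ}

/-- The forward and backward window averages are adjoint. The boundary is exact because the masked
averages vanish outside `1, …, L` and `d ≠ 0`. -/
theorem sum_mul_coupledInput (hd : d ≠ 0) (p p' : ℤ → ℝ) :
    ∑ s ∈ Finset.Icc 1 ((L + m : ℕ) : ℤ), p' s * coupledInput d m (Set.Icc 1 (L : ℤ)) eps p s =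
      ∑ t ∈ Finset.Icc 1 (L : ℤ), eps * maskAvg m (Set.Icc 1 (L : ℤ)) p t ^ d *
        maskAvg m (Set.Icc 1 (L : ℤ)) p' t := by
  have h := sum_window_eq (p := p') (Q := fun t => maskAvg m (Set.Icc 1 (L : ℤ)) p t ^ d) L m
    (fun t ht => by rw [maskAvg_of_notMem ht, zero_pow hd])
  have e1 : ∑ s ∈ Finset.Icc 1 ((L + m : ℕ) : ℤ),
      p' s * coupledInput d m (Set.Icc 1 (L : ℤ)) eps p s =
      eps / (m + 1) * ∑ s ∈ Finset.Icc 1 ((L + m : ℕ) : ℤ), p' s *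
        ∑ k ∈ Finset.range (m + 1), maskAvg m (Set.Icc 1 (L : ℤ)) p (s - k) ^ d := by
    rw [Finset.mul_sum]
    exact Finset.sum_congr rfl fun s _ => by rw [coupledInput]; ring
  rw [e1, ← h, Finset.mul_sum]
  refine Finset.sum_congr rfl fun t ht => ?_
  rw [maskAvg_of_mem (p := p') (by simpa using ht)]
  ring

/-- The new output `p'` is the slope of G at the old input, so convexity of G bounds the change of
the G part by a bilinear expression. Adjointness moves it to the information nodes, where Young's
inequality compares it with the change of the power part. -/
theorem coupledPotential_succ_le (hd : d ≠ 0) (he : 0 ≤ eps) (hy : y ∈ Set.Icc (0 : ℝ) 1) (l : ℕ) :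
    coupledPotential d m L eps y (coupledEvolution d m (Set.Icc 1 (L : ℤ)) eps y (l + 1)) ≤
      coupledPotential d m L eps y (coupledEvolution d m (Set.Icc 1 (L : ℤ)) eps y l) := by
  have h0 := fun l t =>
    (coupledEvolution_mem (d := d) (m := m) (S := Set.Icc 1 (L : ℤ)) he hy l t).1
  have hp' : ∀ s, coupledEvolution d m (Set.Icc 1 (L : ℤ)) eps y (l + 1) s =
    transfer (coupledInput d m (Set.Icc 1 (L : ℤ)) eps
      (coupledEvolution d m (Set.Icc 1 (L : ℤ)) eps y l) s) y := fun s => rfl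
  have h0l := h0 l
  have h0l' := h0 (l + 1)
  generalize coupledEvolution d m (Set.Icc 1 (L : ℤ)) eps y (l + 1) = p' at *
  generalize coupledEvolution d m (Set.Icc 1 (L : ℤ)) eps y l = p at *
  have tangent : ∑ s ∈ Finset.Icc 1 ((L + m : ℕ) : ℤ),
        (p' s * coupledInput d m (Set.Icc 1 (L : ℤ)) eps p' s -
          p' s * coupledInput d m (Set.Icc 1 (L : ℤ)) eps p s) ≤
      ∑ s ∈ Finset.Icc 1 ((L + m : ℕ) : ℤ),
        (transferIntegral (coupledInput d m (Set.Icc 1 (L : ℤ)) eps p' s) y -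
          transferIntegral (coupledInput d m (Set.Icc 1 (L : ℤ)) eps p s) y) := by
    refine Finset.sum_le_sum fun s _ => ?_
    rw [← mul_sub, hp' s]
    exact transfer_mul_sub_le (coupledInput_nonneg he h0l s) (coupledInput_nonneg he h0l' s) hy
  rw [Finset.sum_sub_distrib, Finset.sum_sub_distrib, sum_mul_coupledInput hd,
    sum_mul_coupledInput hd] at tangent
  have young : ∑ t ∈ Finset.Icc 1 (L : ℤ),
        (eps * (d / (d + 1)) * maskAvg m (Set.Icc 1 (L : ℤ)) p' t ^ (d + 1) +
          eps * maskAvg m (Set.Icc 1 (L : ℤ)) p t ^ d * maskAvg m (Set.Icc 1 (L : ℤ)) p' t) ≤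
      ∑ t ∈ Finset.Icc 1 (L : ℤ),
        (eps * (d / (d + 1)) * maskAvg m (Set.Icc 1 (L : ℤ)) p t ^ (d + 1) +
          eps * maskAvg m (Set.Icc 1 (L : ℤ)) p' t ^ d * maskAvg m (Set.Icc 1 (L : ℤ)) p' t) := by
    refine Finset.sum_le_sum fun t _ => ?_
    have hu := maskAvg_nonneg (m := m) (S := Set.Icc 1 (L : ℤ)) h0l t
    have hv := maskAvg_nonneg (m := m) (S := Set.Icc 1 (L : ℤ)) h0l' t
    generalize maskAvg m (Set.Icc 1 (L : ℤ)) p t = u at *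
    generalize maskAvg m (Set.Icc 1 (L : ℤ)) p' t = v at *
    have := young_pow d hu hv
    have e : eps * (d / (d + 1)) * u ^ (d + 1) + eps * v ^ d * v -
        (eps * (d / (d + 1)) * v ^ (d + 1) + eps * u ^ d * v) =
        eps / (d + 1) * (d * u ^ (d + 1) + v ^ (d + 1) - (d + 1) * u ^ d * v) := by
      field_simp
      ring
    have h2 : 0 ≤ eps / (d + 1) * (d * u ^ (d + 1) + v ^ (d + 1) - (d + 1) * u ^ d * v) :=
      mul_nonneg (by positivity) (by linarith)
    linarith
  rw [Finset.sum_add_distrib, Finset.sum_add_distrib] at young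
  unfold coupledPotential
  linarith

theorem coupledPotential_zero_le (hd : d ≠ 0) (he : eps ∈ Set.Icc (0 : ℝ) 1)
    (hy : y ∈ Set.Icc (0 : ℝ) 1) :
    coupledPotential d m L eps y (coupledEvolution d m (Set.Icc 1 (L : ℤ)) eps y 0) ≤
      L * (eps * (d / (d + 1)) - transferIntegral eps y) + m := by
  have hp : coupledEvolution d m (Set.Icc 1 (L : ℤ)) eps y 0 = fun _ => 1 := rfl
  rw [hp, coupledPotential]
  have hu : ∀ t ∈ Finset.Icc 1 (L : ℤ), maskAvg m (Set.Icc 1 (L : ℤ)) (fun _ => 1) t = 1 := by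
    intro t ht
    rw [maskAvg_of_mem (by simpa using ht), sum_range_const_div]
  have hcard : ∀ N : ℕ, (((Finset.Icc 1 (N : ℤ)).card : ℕ) : ℝ) = N := by intro N; simp
  have hx : ∑ s ∈ Finset.Icc 1 ((L + m : ℕ) : ℤ),
      coupledInput d m (Set.Icc 1 (L : ℤ)) eps (fun _ => 1) s = L * eps := by
    have := sum_mul_coupledInput (m := m) (L := L) (eps := eps) hd (fun _ => 1) (fun _ => 1)
    simp only [one_mul] at this
    rw [this, Finset.sum_congr rfl (fun t ht => by rw [hu t ht, one_pow, mul_one, mul_one]),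
      Finset.sum_const, nsmul_eq_mul, hcard]
  -- Jensen's inequality by the tangent at `eps`: the `L + m` inputs sum to `L * eps`, and the
  -- defect `m * eps` at the boundary costs at most `m`.
  have tangent : ∑ s ∈ Finset.Icc 1 ((L + m : ℕ) : ℤ), (transfer eps y *
        (coupledInput d m (Set.Icc 1 (L : ℤ)) eps (fun _ => 1) s - eps)) ≤
      ∑ s ∈ Finset.Icc 1 ((L + m : ℕ) : ℤ),
        (transferIntegral (coupledInput d m (Set.Icc 1 (L : ℤ)) eps (fun _ => 1) s) y -
          transferIntegral eps y) :=
    Finset.sum_le_sum fun s _ => transfer_mul_sub_le he.1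
      (coupledInput_nonneg he.1 (fun _ => zero_le_one) s) hy
  rw [← Finset.mul_sum, Finset.sum_sub_distrib, Finset.sum_sub_distrib, hx, Finset.sum_const,
    Finset.sum_const, nsmul_eq_mul, nsmul_eq_mul, hcard] at tangent
  rw [Finset.sum_congr rfl (fun t ht => by rw [hu t ht, one_pow, mul_one]), Finset.sum_const,
    nsmul_eq_mul, hcard]
  have hg := transfer_mem he.1 hy
  have hG := transferIntegral_nonneg he.1 hy
  have h1 : transfer eps y * eps ≤ 1 := mul_le_one₀ hg.2 he.1 he.2
  have h2 : (m : ℝ) * (transfer eps y * eps) ≤ m * 1 :=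
    mul_le_mul_of_nonneg_left h1 (Nat.cast_nonneg m)
  have h3 : 0 ≤ (m : ℝ) * transferIntegral eps y := mul_nonneg (Nat.cast_nonneg m) hG
  rw [Nat.cast_add] at tangent
  nlinarith

theorem not_tendsto_of_potential_neg (hd : d ≠ 0) (he : eps ∈ Set.Icc (0 : ℝ) 1)
    (hy : y ∈ Set.Icc (0 : ℝ) 1)
    (hneg : L * (eps * (d / (d + 1)) - transferIntegral eps y) + m < 0) :
    ¬ ∀ t ∈ Set.Icc 1 (L : ℤ), Tendsto (fun l => maskAvg m (Set.Icc 1 (L : ℤ))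
        (coupledEvolution d m (Set.Icc 1 (L : ℤ)) eps y l) t) atTop (𝓝 0) := by
  intro H
  have hle : ∀ l, coupledPotential d m L eps y
      (coupledEvolution d m (Set.Icc 1 (L : ℤ)) eps y l) ≤
      L * (eps * (d / (d + 1)) - transferIntegral eps y) + m := by
    intro l
    induction l with
    | zero => exact coupledPotential_zero_le hd he hy
    | succ l ih => exact (coupledPotential_succ_le hd he.1 hy l).trans ih
  -- G(x) ≤ x bounds the potential below by minus the total input, which adjointness with the
  -- constant 1 expresses through the masked averages; it vanishes in the limit if decoding
  -- succeeds.
  have hge : ∀ l, -∑ t ∈ Finset.Icc 1 (L : ℤ), eps * maskAvg m (Set.Icc 1 (L : ℤ))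
        (coupledEvolution d m (Set.Icc 1 (L : ℤ)) eps y l) t ^ d *
          maskAvg m (Set.Icc 1 (L : ℤ)) (fun _ => 1) t ≤
      coupledPotential d m L eps y (coupledEvolution d m (Set.Icc 1 (L : ℤ)) eps y l) := by
    intro l
    have h0 := fun t =>
      (coupledEvolution_mem (d := d) (m := m) (S := Set.Icc 1 (L : ℤ)) he.1 hy l t).1
    rw [← sum_mul_coupledInput hd, coupledPotential]
    have h1 : 0 ≤ ∑ t ∈ Finset.Icc 1 (L : ℤ), eps * (d / (d + 1)) *
        maskAvg m (Set.Icc 1 (L : ℤ))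
          (coupledEvolution d m (Set.Icc 1 (L : ℤ)) eps y l) t ^ (d + 1) :=
      Finset.sum_nonneg fun t _ => mul_nonneg (mul_nonneg he.1 (by positivity))
        (pow_nonneg (maskAvg_nonneg h0 t) _)
    have h2 := Finset.sum_le_sum fun s (_ : s ∈ Finset.Icc 1 ((L + m : ℕ) : ℤ)) =>
      transferIntegral_le (coupledInput_nonneg (d := d) (m := m) (S := Set.Icc 1 (L : ℤ))
        he.1 h0 s) hy
    simp only [one_mul]
    linarith
  have hlim : Tendsto (fun l => -∑ t ∈ Finset.Icc 1 (L : ℤ), eps * maskAvg m (Set.Icc 1 (L : ℤ))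
        (coupledEvolution d m (Set.Icc 1 (L : ℤ)) eps y l) t ^ d *
          maskAvg m (Set.Icc 1 (L : ℤ)) (fun _ => 1) t) atTop (𝓝 0) := by
    rw [← neg_zero, ← Finset.sum_const_zero (ι := ℤ) (s := Finset.Icc 1 (L : ℤ))]
    refine (tendsto_finsetSum _ fun t ht => ?_).neg
    have := (((H t (by simpa using ht)).pow d).const_mul eps).mul_const
      (maskAvg m (Set.Icc 1 (L : ℤ)) (fun _ => 1) t)
    simpa [hd] using this
  have := le_of_tendsto' hlim fun l => (hge l).trans (hle l)
  linarith

end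

/-! ### Threshold saturation -/

theorem Icc_one_natCast_succ (N : ℕ) :
    Finset.Icc 1 ((N + 1 : ℕ) : ℤ) = insert ((N : ℤ) + 1) (Finset.Icc 1 (N : ℤ)) := by
  ext t
  simp only [Finset.mem_Icc, Finset.mem_insert, Nat.cast_add, Nat.cast_one]
  omega

theorem sum_Icc_one_succ (N : ℕ) (f : ℤ → ℝ) :
    ∑ t ∈ Finset.Icc 1 ((N + 1 : ℕ) : ℤ), f t =
      ∑ t ∈ Finset.Icc 1 (N : ℤ), f t + f ((N : ℤ) + 1) := by
  rw [Icc_one_natCast_succ, Finset.sum_insert (by simp), add_comm]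

section
variable {d m : ℕ} {eps y : ℝ} {p : ℤ → ℝ}

theorem maskAvg_Ici_monotone (hp0 : ∀ t, 0 ≤ p t) (hp : Monotone p) :
    Monotone (maskAvg m (Set.Ici 1) p) := by
  intro s t hst
  by_cases hs : s ∈ Set.Ici (1 : ℤ)
  · rw [maskAvg_of_mem hs, maskAvg_of_mem (Set.mem_Ici.2 (le_trans hs hst))]
    exact div_le_div_of_nonneg_right (Finset.sum_le_sum fun _ _ => hp (by omega)) (by positivity)
  · rw [maskAvg_of_notMem hs]
    exact maskAvg_nonneg hp0 t

theorem coupledInput_Ici_monotone (he : 0 ≤ eps) (hp0 : ∀ t, 0 ≤ p t) (hp : Monotone p) :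
    Monotone (coupledInput d m (Set.Ici 1) eps p) := fun _ _ hst =>
  mul_le_mul_of_nonneg_left (Finset.sum_le_sum fun _ _ => pow_le_pow_left₀
    (maskAvg_nonneg hp0 _) (maskAvg_Ici_monotone hp0 hp (by omega)) _) (by positivity)

theorem coupledEvolution_Ici_monotone (he : 0 ≤ eps) (hy : y ∈ Set.Icc (0 : ℝ) 1) (l : ℕ) :
    Monotone (coupledEvolution d m (Set.Ici 1) eps y l) := by
  induction l with
  | zero => exact monotone_const
  | succ l ih =>
    have h0 := fun t => (coupledEvolution_mem (d := d) (m := m) (S := Set.Ici 1) he hy l t).1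
    exact fun s t hst => transfer_mono (coupledInput_nonneg he h0 s)
      (coupledInput_Ici_monotone he h0 ih hst) hy

theorem coupledInput_sub (t : ℤ) (S : Set ℤ) :
    coupledInput d m S eps p t - coupledInput d m S eps p (t - 1) =
      eps / (m + 1) * ∑ k ∈ Finset.range (m + 1),
        (maskAvg m S p (t - k) ^ d - maskAvg m S p (t - k - 1) ^ d) := by
  rw [coupledInput, coupledInput, Finset.sum_sub_distrib, mul_sub]
  simp only [sub_right_comm]

/-- The difference of two adjacent window sums telescopes to its two end terms. This is where a
large coupling memory makes the profile smooth. -/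
theorem coupledInput_sub_le (he : eps ∈ Set.Icc (0 : ℝ) 1) (hp0 : ∀ t, 0 ≤ p t)
    (hp1 : ∀ t, p t ≤ 1) (t : ℤ) (S : Set ℤ) :
    coupledInput d m S eps p t - coupledInput d m S eps p (t - 1) ≤ 1 / (m + 1) := by
  have h := Finset.sum_range_sub' (fun k : ℕ => maskAvg m S p (t - k) ^ d) (m + 1)
  simp only [Nat.cast_add, Nat.cast_one, ← sub_sub] at h
  rw [coupledInput_sub, h]
  have h1 : maskAvg m S p (t - (0 : ℕ)) ^ d ≤ 1 :=
    pow_le_one₀ (maskAvg_nonneg hp0 _) (maskAvg_le_one hp1 _)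
  have h2 : 0 ≤ maskAvg m S p (t - m - 1) ^ d := pow_nonneg (maskAvg_nonneg hp0 _) _
  rw [div_mul_eq_mul_div]
  refine div_le_div_of_nonneg_right ?_ (by positivity)
  exact (mul_le_mul_of_nonneg_left (by linarith) he.1).trans ((mul_one eps).le.trans he.2)

/-- The potential of the limiting value of a monotone fixed point, up to shifted indices, is at
most the mesh `1 / (m + 1)` of the fixed point. -/
theorem fixedPoint_potential_le (hd : d ≠ 0) (he : eps ∈ Set.Icc (0 : ℝ) 1)
    (hy : y ∈ Set.Icc (0 : ℝ) 1) (hp : ∀ t, p t ∈ Set.Icc (0 : ℝ) 1) (hmono : Monotone p)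
    (hfix : ∀ t, p t = transfer (coupledInput d m (Set.Ici 1) eps p t) y) (M : ℕ) :
    eps * (d / (d + 1)) * maskAvg m (Set.Ici 1) p M ^ (d + 1) ≤
      transferIntegral (coupledInput d m (Set.Ici 1) eps p ((M + m : ℕ) : ℤ)) y + 1 / (m + 1) := by
  have hp0 := fun t => (hp t).1
  have hp1 := fun t => (hp t).2
  have hu0 := maskAvg_nonneg (m := m) (S := Set.Ici 1) hp0
  have hx0 := coupledInput_nonneg (d := d) (m := m) (S := Set.Ici 1) he.1 hp0
  have hxm := coupledInput_Ici_monotone (d := d) (m := m) he.1 hp0 hmono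
  have hum := maskAvg_Ici_monotone (m := m) hp0 hmono
  -- An upper Riemann sum of the transfer function along the profile of inputs. It exceeds the
  -- integral by at most the mesh times the total increase of `p`.
  have riemann : ∀ N : ℕ, ∑ s ∈ Finset.Icc 1 (N : ℤ), p s *
      (coupledInput d m (Set.Ici 1) eps p s - coupledInput d m (Set.Ici 1) eps p (s - 1)) ≤
      transferIntegral (coupledInput d m (Set.Ici 1) eps p N) y + 1 / (m + 1) * p N := by
    intro N
    induction N with
    | zero =>
      simp only [Nat.cast_zero, Finset.Icc_eq_empty (by norm_num : ¬ (1 : ℤ) ≤ 0),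
        Finset.sum_empty]
      exact add_nonneg (transferIntegral_nonneg (hx0 _) hy) (mul_nonneg (by positivity) (hp0 _))
    | succ N ih =>
      rw [sum_Icc_one_succ, add_sub_cancel_right]
      push_cast
      have h1 := transfer_mul_sub_le (hx0 N) (hx0 (N + 1)) hy
      rw [← hfix] at h1
      have h2 := coupledInput_sub_le (d := d) (m := m) he hp0 hp1 (N + 1) (Set.Ici 1)
      rw [add_sub_cancel_right] at h2
      have h3 := mul_le_mul_of_nonneg_left h2 (sub_nonneg.2 (hmono (by omega : (N : ℤ) ≤ N + 1)))
      nlinarith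
  -- Windows starting at times up to `M` reach time `M + m`; the extra terms on the right are
  -- nonnegative because the profile is increasing.
  have parts : eps / (m + 1) * ∑ t ∈ Finset.Icc 1 (M : ℤ),
        (maskAvg m (Set.Ici 1) p t ^ d - maskAvg m (Set.Ici 1) p (t - 1) ^ d) *
          ∑ j ∈ Finset.range (m + 1), p (t + j) ≤
      ∑ s ∈ Finset.Icc 1 ((M + m : ℕ) : ℤ), p s * (coupledInput d m (Set.Ici 1) eps p s -
        coupledInput d m (Set.Ici 1) eps p (s - 1)) := by
    have h := sum_window_le (p := p) (Q := fun t => maskAvg m (Set.Ici 1) p t ^ d -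
      maskAvg m (Set.Ici 1) p (t - 1) ^ d) hp0
      (fun t => sub_nonneg.2 (pow_le_pow_left₀ (hu0 _) (hum (by omega)) d)) M m
    refine (mul_le_mul_of_nonneg_left h (div_nonneg he.1 (by positivity))).trans_eq ?_
    rw [Finset.mul_sum]
    refine Finset.sum_congr rfl fun s _ => ?_
    rw [coupledInput_sub]
    ring
  -- The sum on the right is an upper sum for the integral of u d(u^d), starting from the value 0 at
  -- the masked time 0.
  have upper : ∀ N : ℕ, (d / (d + 1) : ℝ) * maskAvg m (Set.Ici 1) p N ^ (d + 1) ≤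
      ∑ t ∈ Finset.Icc 1 (N : ℤ), (maskAvg m (Set.Ici 1) p t ^ d -
        maskAvg m (Set.Ici 1) p (t - 1) ^ d) * maskAvg m (Set.Ici 1) p t := by
    intro N
    induction N with
    | zero =>
      rw [maskAvg_of_notMem (by simp)]
      simp
    | succ N ih =>
      rw [sum_Icc_one_succ, add_sub_cancel_right]
      push_cast
      have hy := young_pow d (hu0 N) (hu0 (N + 1))
      generalize maskAvg m (Set.Ici 1) p N = u at *
      generalize maskAvg m (Set.Ici 1) p (N + 1) = v at *
      have e : (d / (d + 1) : ℝ) * u ^ (d + 1) + (v ^ d - u ^ d) * v -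
          (d / (d + 1) : ℝ) * v ^ (d + 1) =
          1 / (d + 1) * (d * u ^ (d + 1) + v ^ (d + 1) - (d + 1) * u ^ d * v) := by
        field_simp
        ring
      have h2 : 0 ≤ 1 / ((d : ℝ) + 1) *
          (d * u ^ (d + 1) + v ^ (d + 1) - (d + 1) * u ^ d * v) :=
        mul_nonneg (by positivity) (by linarith)
      linarith
  have e1 : eps / (m + 1) * ∑ t ∈ Finset.Icc 1 (M : ℤ),
        (maskAvg m (Set.Ici 1) p t ^ d - maskAvg m (Set.Ici 1) p (t - 1) ^ d) *
          ∑ j ∈ Finset.range (m + 1), p (t + j) =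
      eps * ∑ t ∈ Finset.Icc 1 (M : ℤ), (maskAvg m (Set.Ici 1) p t ^ d -
        maskAvg m (Set.Ici 1) p (t - 1) ^ d) * maskAvg m (Set.Ici 1) p t := by
    rw [Finset.mul_sum, Finset.mul_sum]
    refine Finset.sum_congr rfl fun t ht => ?_
    have h : maskAvg m (Set.Ici 1) p t = (∑ j ∈ Finset.range (m + 1), p (t + j)) / (m + 1) :=
      maskAvg_of_mem (Finset.mem_Icc.1 ht).1
    nth_rewrite 3 [h]
    ring
  have h1 := mul_le_mul_of_nonneg_left (upper M) he.1
  have h2 := riemann (M + m)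
  have h3 : 1 / ((m : ℝ) + 1) * p ((M + m : ℕ) : ℤ) ≤ 1 / (m + 1) :=
    mul_le_of_le_one_right (by positivity) (hp1 _)
  rw [e1] at parts
  linarith

theorem tendsto_maskAvg {ι : Type*} {F : Filter ι} {P : ι → ℤ → ℝ} (S : Set ℤ)
    (h : ∀ t, Tendsto (fun i => P i t) F (𝓝 (p t))) (t : ℤ) :
    Tendsto (fun i => maskAvg m S (P i) t) F (𝓝 (maskAvg m S p t)) := by
  by_cases ht : t ∈ S
  · simp only [maskAvg_of_mem ht]
    exact (tendsto_finsetSum _ fun _ _ => h _).div_const _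
  · simp only [maskAvg_of_notMem ht]
    exact tendsto_const_nhds

/-- If the potential of the uncoupled system exceeds `1 / (m + 1)` at its nonzero fixed points, then
density evolution of the system that is coupled from time `1` on converges to zero. -/
theorem coupledEvolution_Ici_tendsto_zero (hd : d ≠ 0) (he : eps ∈ Set.Icc (0 : ℝ) 1)
    (hy0 : 0 ≤ y) (hy1 : y < 1)
    (hV : ∀ u ∈ Set.Ioc (0 : ℝ) 1, u = transfer (eps * u ^ d) y →
      1 / (m + 1) < eps * (d / (d + 1)) * u ^ (d + 1) - transferIntegral (eps * u ^ d) y) (t : ℤ) :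
    Tendsto (fun l => coupledEvolution d m (Set.Ici 1) eps y l t) atTop (𝓝 0) := by
  have hy : y ∈ Set.Icc (0 : ℝ) 1 := ⟨hy0, hy1.le⟩
  have hmem := coupledEvolution_mem (d := d) (m := m) (S := Set.Ici 1) he.1 hy
  obtain ⟨p, hlim⟩ : ∃ p : ℤ → ℝ, ∀ t,
      Tendsto (fun l => coupledEvolution d m (Set.Ici 1) eps y l t) atTop (𝓝 (p t)) :=
    ⟨fun t => ⨅ l, coupledEvolution d m (Set.Ici 1) eps y l t, fun t =>
      tendsto_atTop_ciInf (coupledEvolution_antitone he.1 hy t)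
        ⟨0, by rintro _ ⟨l, rfl⟩; exact (hmem l t).1⟩⟩
  have hp : ∀ t, p t ∈ Set.Icc (0 : ℝ) 1 := fun t =>
    isClosed_Icc.mem_of_tendsto (hlim t) (Eventually.of_forall fun l => hmem l t)
  have hp0 := fun t => (hp t).1
  have hmono : Monotone p := fun s t hst =>
    le_of_tendsto_of_tendsto' (hlim s) (hlim t) fun l =>
      coupledEvolution_Ici_monotone he.1 hy l hst
  have hfix : ∀ t, p t = transfer (coupledInput d m (Set.Ici 1) eps p t) y := by
    intro t
    have hin : Tendsto (fun l => coupledInput d m (Set.Ici 1) eps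
        (coupledEvolution d m (Set.Ici 1) eps y l) t) atTop
        (𝓝 (coupledInput d m (Set.Ici 1) eps p t)) :=
      (tendsto_finsetSum _ fun _ _ => (tendsto_maskAvg _ hlim _).pow d).const_mul _
    exact tendsto_nhds_unique ((hlim t).comp (tendsto_add_atTop_nat 1))
      ((continuousAt_transfer (coupledInput_nonneg he.1 hp0 t) hy0 hy1).tendsto.comp hin)
  obtain ⟨u, hu⟩ : ∃ u, Tendsto p atTop (𝓝 u) :=
    ⟨_, tendsto_atTop_ciSup hmono ⟨1, by rintro _ ⟨t, rfl⟩; exact (hp t).2⟩⟩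
  have hu01 : u ∈ Set.Icc (0 : ℝ) 1 := isClosed_Icc.mem_of_tendsto hu (Eventually.of_forall hp)
  have hshift : ∀ c : ℤ, Tendsto (fun t : ℤ => t + c) atTop atTop := fun c =>
    tendsto_atTop_add_const_right _ c tendsto_id
  have hulim : Tendsto (maskAvg m (Set.Ici 1) p) atTop (𝓝 u) := by
    have hs : Tendsto (fun t : ℤ => ∑ j ∈ Finset.range (m + 1), p (t + (j : ℤ))) atTop
        (𝓝 (∑ _j ∈ Finset.range (m + 1), u)) :=
      tendsto_finsetSum _ fun j _ => hu.comp (hshift (j : ℤ))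
    have h := hs.div_const ((m : ℝ) + 1)
    rw [sum_range_const_div] at h
    refine h.congr' ?_
    filter_upwards [eventually_ge_atTop 1] with t ht
    exact (maskAvg_of_mem (S := Set.Ici 1) ht).symm
  have hxlim : Tendsto (coupledInput d m (Set.Ici 1) eps p) atTop (𝓝 (eps * u ^ d)) := by
    have hsub : ∀ k : ℕ, Tendsto (fun t : ℤ => maskAvg m (Set.Ici 1) p (t - k)) atTop (𝓝 u) :=
      fun k => by simpa only [sub_eq_add_neg, Function.comp_def] using hulim.comp (hshift (-(k : ℤ)))
    have h : Tendsto (fun t : ℤ => eps / ((m : ℝ) + 1) * ∑ k ∈ Finset.range (m + 1),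
        maskAvg m (Set.Ici 1) p (t - k) ^ d) atTop
        (𝓝 (eps / (m + 1) * ∑ _k ∈ Finset.range (m + 1), u ^ d)) :=
      (tendsto_finsetSum _ fun k _ => (hsub k).pow d).const_mul _
    rwa [div_mul_eq_mul_div, mul_div_assoc, sum_range_const_div] at h
  have hx0 : 0 ≤ eps * u ^ d := mul_nonneg he.1 (pow_nonneg hu01.1 d)
  have hufix : u = transfer (eps * u ^ d) y := by
    refine tendsto_nhds_unique hu ?_
    rw [funext hfix]
    exact (continuousAt_transfer hx0 hy0 hy1).tendsto.comp hxlim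
  have hpot : eps * (d / (d + 1)) * u ^ (d + 1) ≤
      transferIntegral (eps * u ^ d) y + 1 / (m + 1) := by
    refine le_of_tendsto_of_tendsto'
      (((hulim.comp tendsto_natCast_atTop_atTop).pow (d + 1)).const_mul _)
      (((continuousAt_transferIntegral hx0 hy0 hy1).tendsto.comp (hxlim.comp
        (tendsto_natCast_atTop_atTop.comp (tendsto_add_atTop_nat m)))).add_const _)
      fun M => fixedPoint_potential_le hd he hy hp hmono hfix M
  -- The limit `u` is a fixed point of the uncoupled recursion with potential at most 1/(m+1), so it
  -- is 0, and monotonicity in time makes the whole profile 0.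
  have hu0 : u = 0 := by
    by_contra h
    have := hV u ⟨lt_of_le_of_ne hu01.1 (Ne.symm h), hu01.2⟩ hufix
    linarith
  have hpt : p t = 0 := le_antisymm (hu0 ▸ hmono.ge_of_tendsto hu t) (hp0 t)
  exact hpt ▸ hlim t

theorem maskAvg_Icc_tendsto_zero (L : ℕ) (he : eps ∈ Set.Icc (0 : ℝ) 1)
    (hy : y ∈ Set.Icc (0 : ℝ) 1)
    (h : ∀ t, Tendsto (fun l => coupledEvolution d m (Set.Ici 1) eps y l t) atTop (𝓝 0)) (t : ℤ) :
    Tendsto (fun l => maskAvg m (Set.Icc 1 (L : ℤ))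
      (coupledEvolution d m (Set.Icc 1 (L : ℤ)) eps y l) t) atTop (𝓝 0) := by
  have hlim : ∀ t, Tendsto (fun l => coupledEvolution d m (Set.Icc 1 (L : ℤ)) eps y l t) atTop
      (𝓝 0) := fun t => squeeze_zero (fun l => (coupledEvolution_mem he.1 hy l t).1)
    (fun l => coupledEvolution_mono he.1 hy Set.Icc_subset_Ici_self l t) (h t)
  have := tendsto_maskAvg (m := m) (p := fun _ => 0) (Set.Icc 1 (L : ℤ)) hlim t
  simpa [maskAvg, Set.indicator_apply] using this

end

/-! ### The potential of the uncoupled system -/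

section
variable {d : ℕ} {eps y u : ℝ}

/-- Factoring out `eps * u ^ (d + 1)` leaves a quotient whose denominator is at most 1 and whose
numerator is smallest when u^(d-1) - d/(d+1) u^d is largest. Young's inequality bounds that by 1/d.
-/
theorem potential_ge (hd : d ≠ 0) (he : eps ∈ Set.Icc (0 : ℝ) 1) (hy0 : 0 ≤ y) (hy1 : y < 1)
    (hu : u ∈ Set.Icc (0 : ℝ) 1) (hk : 0 < d / (d + 1) * (1 - y) - eps * y / d) :
    eps * u ^ (d + 1) * (d / (d + 1) * (1 - y) - eps * y / d) ≤
      eps * (d / (d + 1)) * u ^ (d + 1) - transferIntegral (eps * u ^ d) y := by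
  obtain ⟨n, rfl⟩ := Nat.exists_eq_succ_of_ne_zero hd
  rw [Nat.succ_eq_add_one] at *
  have hn : (0 : ℝ) < ((n + 1 : ℕ) : ℝ) := by positivity
  set c : ℝ := ((n + 1 : ℕ) : ℝ) with hc
  have hcn : c = n + 1 := by rw [hc]; push_cast; ring
  have hey : 0 ≤ eps * y := mul_nonneg he.1 hy0
  have hun : 0 ≤ u ^ (n + 1) := pow_nonneg hu.1 _
  set D := 1 - y + eps * u ^ (n + 1) * y with hD
  have hD0 : 0 < D := by
    have := mul_nonneg hey hun
    nlinarith
  have hD1 : D ≤ 1 := by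
    have h1 : eps * u ^ (n + 1) ≤ 1 := mul_le_one₀ he.2 hun (pow_le_one₀ hu.1 hu.2)
    have := mul_le_mul_of_nonneg_right h1 hy0
    linarith
  have young : c * u ^ n ≤ n * u ^ (n + 1) + 1 := by
    have := young_pow n hu.1 zero_le_one
    simpa [hcn] using this
  -- With c = n + 1 this is (c-1)(c+1) ≤ c².
  have hcoef : (n : ℝ) ≤ c * (c / (c + 1)) := by
    rw [← mul_div_assoc, le_div_iff₀ (by positivity), hcn]
    nlinarith
  have hcu : u ^ n - c / (c + 1) * u ^ (n + 1) ≤ 1 / c := by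
    rw [le_div_iff₀ hn]
    have := mul_le_mul_of_nonneg_right hcoef hun
    linarith
  have hN : c / (c + 1) * (1 - y) - eps * y / c ≤ c / (c + 1) * D - eps * y * u ^ n := by
    have h := mul_le_mul_of_nonneg_left hcu hey
    rw [hD]
    have e : eps * y / c = eps * y * (1 / c) := by ring
    rw [e]
    nlinarith
  have hV : eps * (c / (c + 1)) * u ^ (n + 1 + 1) - transferIntegral (eps * u ^ (n + 1)) y =
      eps * u ^ (n + 1 + 1) * ((c / (c + 1) * D - eps * y * u ^ n) / D) := by
    rw [transferIntegral, ← hD]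
    field_simp
    ring
  rw [hV]
  refine mul_le_mul_of_nonneg_left ?_ (mul_nonneg he.1 (pow_nonneg hu.1 _))
  rw [le_div_iff₀ hD0]
  nlinarith

theorem transfer_le {x : ℝ} (hx : 0 ≤ x) (hy0 : 0 ≤ y) (hy1 : y < 1) :
    transfer x y ≤ 2 * x / (1 - y) := by
  have hb : 0 < 1 - y := by linarith
  have hxy := mul_nonneg hx hy0
  have hD : 0 < 1 - y + x * y := by linarith
  set r := (1 - y) / (1 - y + x * y) with hr
  have hr2 : 1 - r ≤ x / (1 - y) := by
    rw [hr, one_sub_div hD.ne', div_le_div_iff₀ hD hb]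
    have h1 : 0 ≤ x * (1 - y) * (1 - y) := by positivity
    have h2 : 0 ≤ x * (x * y) := by positivity
    nlinarith
  have : transfer x y ≤ 2 * (1 - r) := by
    rw [transfer, ← hr]
    nlinarith [sq_nonneg (1 - r)]
  rw [mul_div_assoc]
  linarith

/-- The nonzero fixed points of the uncoupled system are bounded away from zero. -/
theorem fixedPoint_pow_ge (hd : 3 ≤ d) (he : eps ∈ Set.Icc (0 : ℝ) 1) (hy0 : 0 ≤ y) (hy1 : y < 1)
    (hu : u ∈ Set.Ioc (0 : ℝ) 1) (hfix : u = transfer (eps * u ^ d) y) :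
    ((1 - y) / 2) ^ 2 ≤ u ^ (d + 1) := by
  obtain ⟨n, rfl⟩ := Nat.exists_eq_add_of_le' (by omega : 1 ≤ d)
  have hb : 0 < 1 - y := by linarith
  have h := transfer_le (mul_nonneg he.1 (pow_nonneg hu.1.le (n + 1))) hy0 hy1
  rw [← hfix, le_div_iff₀ hb, pow_succ] at h
  have h1 : (1 - y) / 2 ≤ u ^ n := by
    have hun : 0 < u ^ n := pow_pos hu.1 n
    have h2 : eps * (u ^ n * u) ≤ 1 * (u ^ n * u) :=
      mul_le_mul_of_nonneg_right he.2 (mul_nonneg hun.le hu.1.le)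
    have h3 : u * (1 - y) ≤ u * (2 * u ^ n) := by linarith
    have := le_of_mul_le_mul_left h3 hu.1
    linarith
  -- Squaring suffices to reach the exponent `d + 1`, since `d ≥ 3` means 2(d-1) ≥ d+1.
  calc ((1 - y) / 2) ^ 2 ≤ (u ^ n) ^ 2 := pow_le_pow_left₀ (by linarith) h1 2
    _ = u ^ (n * 2) := (pow_mul _ _ _).symm
    _ ≤ u ^ (n + 1 + 1) := pow_le_pow_of_le_one hu.1.le hu.2 (by omega)

end

/-! ### Rates -/

theorem survivingFraction_eq {R : ℝ} {q : ℕ} (hq : 1 ≤ q) :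
    survivingFraction R q (1 / q) = (1 - R) / (2 * q * R) := by
  have hq' : (q : ℝ) ≠ 0 := by positivity
  have h1 : 1 - ((q : ℝ) - 1) * (1 / q) = 1 / q := by field_simp; ring
  have h3 : (1 / motherRate - 1 : ℝ) = 2 := by norm_num [motherRate]
  rw [survivingFraction, h1, h3, div_mul_eq_mul_div, one_mul, div_div]
  congr 1
  ring

theorem survivingFraction_mem {R : ℝ} (hR0 : 0 < R) (hR1 : R < 1) {q : ℕ} (hq : 1 ≤ q)
    (hR : 1 / (q * (1 / motherRate - 1) + 1) ≤ R) :
    survivingFraction R q (1 / q) ∈ Set.Ioc (0 : ℝ) 1 := by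
  have hq' : (0 : ℝ) < q := by exact_mod_cast hq
  rw [survivingFraction_eq hq]
  refine ⟨div_pos (by linarith) (by positivity), (div_le_one (by positivity)).2 ?_⟩
  have h3 : (1 / motherRate - 1 : ℝ) = 2 := by norm_num [motherRate]
  rw [h3, div_le_iff₀ (by positivity)] at hR
  linarith

theorem tendsto_codeRate {R : ℝ} (hR0 : 0 < R) {q : ℕ} (hq : 1 ≤ q) (m : ℕ) :
    Tendsto (fun L : ℕ => codeRate q (1 / q) (survivingFraction R q (1 / q)) m L) atTop (𝓝 R) := by
  have hq' : (0 : ℝ) < q := by exact_mod_cast hq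
  have h3 : (1 / motherRate - 1 : ℝ) = 2 := by norm_num [motherRate]
  have h1 : (1 - ((q : ℝ) - 1) * (1 / q)) = 1 / q := by field_simp; ring
  have hlim : Tendsto (fun L : ℕ => R / (1 + m * (1 - R) / (L : ℝ))) atTop (𝓝 (R / (1 + 0))) :=
    tendsto_const_nhds.div (tendsto_const_nhds.add (tendsto_const_div_atTop_nhds_zero_nat _))
      (by norm_num)
  rw [add_zero, div_one] at hlim
  refine hlim.congr' ?_
  filter_upwards [eventually_gt_atTop 0] with L hL
  have hL' : (0 : ℝ) < L := by exact_mod_cast hL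
  rw [codeRate, survivingFraction_eq hq, h1, h3]
  have e : (L : ℝ) * (1 / q) + (L + m) * (2 * ((1 - R) / (2 * q * R))) =
      (1 + m * (1 - R) / L) * (L / (q * R)) := by
    field_simp
    ring
  rw [e, div_mul_eq_div_div_swap]
  congr 1
  field_simp

/-! ### The BP threshold -/

/-- The hypothesis `hk` is ε(d+1) < d²(1-y) cleared of `d`, and makes the constant of `potential_ge`
positive. The resulting lower bound for V does not involve `m` or `L`, so large `m` works for all
`L` at once. -/
theorem bpSucceeds_of_potential_pos {q : ℕ} (hq : 2 ≤ q) {eps rho : ℝ} (he0 : 0 < eps)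
    (he1 : eps < 1) (hrho : rho ∈ Set.Ioc (0 : ℝ) 1)
    (hk : eps * (2 * q) ^ 2 < (2 * q - 1) ^ 2 * ((1 - eps) * rho * (2 * q))) :
    ∀ᶠ m : ℕ in atTop, ∀ L : ℕ,
      BPSucceeds infoTransfer infoTransfer q (1 / q) rho m L eps := by
  have he : eps ∈ Set.Icc (0 : ℝ) 1 := ⟨he0.le, he1.le⟩
  have hb0 : 0 < (1 - eps) * rho := mul_pos (by linarith) hrho.1
  have hb1 : (1 - eps) * rho ≤ 1 := mul_le_one₀ (by linarith) hrho.1.le hrho.2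
  obtain ⟨y, hy⟩ : ∃ y, y = 1 - (1 - eps) * rho := ⟨_, rfl⟩
  have hy0 : 0 ≤ y := by linarith
  have hy1 : y < 1 := by linarith
  obtain ⟨d, hd⟩ : ∃ d, d = 2 * q - 1 := ⟨_, rfl⟩
  have hdq : (2 : ℝ) * q = d + 1 := by
    have : 2 * q = d + 1 := by omega
    exact_mod_cast this
  have hd0 : (0 : ℝ) < d := by
    have : 0 < d := by omega
    exact_mod_cast this
  have hkap : 0 < d / (d + 1) * (1 - y) - eps * y / d := by
    rw [hdq, add_sub_cancel_right, show (1 - eps) * rho = 1 - y by linarith] at hk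
    have h1 : eps * y ≤ eps := mul_le_of_le_one_right he0.le hy1.le
    rw [sub_pos, div_lt_iff₀ hd0]
    have : eps < d / (d + 1) * (1 - y) * d := by
      rw [div_mul_eq_mul_div, div_mul_eq_mul_div, lt_div_iff₀ (by positivity)]
      have hpos : (0 : ℝ) < d + 1 := by positivity
      nlinarith
    linarith
  set kap := d / (d + 1) * (1 - y) - eps * y / d with hkapdef
  have hc : 0 < eps * ((1 - y) / 2) ^ 2 * kap := by
    have : 0 < 1 - y := by linarith
    positivity
  filter_upwards [(tendsto_one_div_add_atTop_nhds_zero_nat (𝕜 := ℝ)).eventually_lt_const hc]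
    with m hm L
  have hyI : y ∈ Set.Icc (0 : ℝ) 1 := ⟨hy0, hy1.le⟩
  rw [bpSucceeds_iff (by omega) m L he (hy ▸ hyI), ← hy, ← hd]
  refine fun t _ => maskAvg_Icc_tendsto_zero L he hyI
    (coupledEvolution_Ici_tendsto_zero (by omega) he hy0 hy1 fun u hu hfix => ?_) t
  refine hm.trans_le (le_trans ?_
    (potential_ge (by omega) he hy0 hy1 ⟨hu.1.le, hu.2⟩ hkap))
  exact mul_le_mul_of_nonneg_right (mul_le_mul_of_nonneg_left
    (fixedPoint_pow_ge (by omega) he hy0 hy1 hu hfix) he0.le) hkap.le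

/-- The bound on V(1) is uniform in `eps ≥ 1 - R + del`, so one `L` excludes them all. This is
needed because success is not shown to be monotone in `eps`. -/
theorem not_bpSucceeds_of_lt {R del : ℝ} (hR0 : 0 < R) (hR1 : R < 1) (hdel : 0 < del) {q : ℕ}
    (hq : 1 ≤ q) (hrho : survivingFraction R q (1 / q) ∈ Set.Ioc (0 : ℝ) 1) (m : ℕ) :
    ∀ᶠ L : ℕ in atTop, ∀ eps : ℝ, 1 - R + del ≤ eps → eps ≤ 1 →
      ¬ BPSucceeds infoTransfer infoTransfer q (1 / q) (survivingFraction R q (1 / q)) m L eps := by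
  have hq' : (0 : ℝ) < q := by exact_mod_cast hq
  have hc : 0 < (1 - R) / (2 * q) * (del / R) := by
    have : 0 < 1 - R := by linarith
    positivity
  filter_upwards [(tendsto_natCast_atTop_atTop.atTop_mul_const hc).eventually_gt_atTop (m : ℝ)]
    with L hL eps hge he1
  have he0 : 0 < eps := by linarith
  have he : eps ∈ Set.Icc (0 : ℝ) 1 := ⟨he0.le, he1⟩
  have hb0 : 0 ≤ (1 - eps) * survivingFraction R q (1 / q) := mul_nonneg (by linarith) hrho.1.le
  have hb1 : (1 - eps) * survivingFraction R q (1 / q) ≤ 1 :=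
    mul_le_one₀ (by linarith) hrho.1.le hrho.2
  have hyI : 1 - (1 - eps) * survivingFraction R q (1 / q) ∈ Set.Icc (0 : ℝ) 1 :=
    ⟨by linarith, by linarith⟩
  rw [bpSucceeds_iff hq m L he hyI]
  refine not_tendsto_of_potential_neg (by omega) he hyI ?_
  have hdq : ((2 * q - 1 : ℕ) : ℝ) + 1 = 2 * q := by
    have : 2 * q - 1 + 1 = 2 * q := by omega
    exact_mod_cast this
  have hbq : (1 - eps) * survivingFraction R q (1 / q) * (2 * q) = (1 - eps) * (1 - R) / R := by
    rw [survivingFraction_eq hq]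
    field_simp
  rw [hdq, show ((2 * q - 1 : ℕ) : ℝ) = 2 * q - 1 by linarith]
  generalize (1 - eps) * survivingFraction R q (1 / q) = b at *
  have hD0 : 0 < 1 - (1 - b) + eps * (1 - b) := by nlinarith
  have hD1 : 1 - (1 - b) + eps * (1 - b) ≤ 1 := by nlinarith
  have hV : eps * ((2 * q - 1) / (2 * q)) - transferIntegral eps (1 - b) =
      -(eps / (2 * q) * (eps - (2 * q - 1 + eps) * b) / (1 - (1 - b) + eps * (1 - b))) := by
    rw [transferIntegral]
    field_simp
    ring
  -- Bounding 2q - 1 + ε by 2q cancels the factor 2q of the puncturing and leaves (ε - (1-R))/R.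
  have hnum : del / R ≤ eps - (2 * q - 1 + eps) * b := by
    have h1 : (2 * q - 1 + eps) * b ≤ b * (2 * q) := by nlinarith
    have h2 : eps - (1 - eps) * (1 - R) / R = (eps - (1 - R)) / R := by
      field_simp
      ring
    have h3 : del / R ≤ (eps - (1 - R)) / R := div_le_div_of_nonneg_right (by linarith) hR0.le
    linarith
  have hbound : (1 - R) / (2 * q) * (del / R) ≤
      eps / (2 * q) * (eps - (2 * q - 1 + eps) * b) / (1 - (1 - b) + eps * (1 - b)) := by
    have h1 : (1 - R) / (2 * q) * (del / R) ≤
        eps / (2 * q) * (eps - (2 * q - 1 + eps) * b) :=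
      mul_le_mul (div_le_div_of_nonneg_right (by linarith) (by positivity)) hnum
        (by positivity) (by positivity)
    exact h1.trans (le_div_self (hc.le.trans h1) hD0 hD1)
  rw [hV]
  have := mul_le_mul_of_nonneg_left hbound (Nat.cast_nonneg L : (0 : ℝ) ≤ L)
  linarith

theorem eventually_survivingFraction_mem {R : ℝ} (hR0 : 0 < R) (hR1 : R < 1) :
    ∀ᶠ q : ℕ in atTop, survivingFraction R q (1 / q) ∈ Set.Ioc (0 : ℝ) 1 := by
  have h := tendsto_const_div_atTop_nhds_zero_nat ((1 - R) / (2 * R))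
  filter_upwards [h.eventually_lt_const zero_lt_one, eventually_ge_atTop 1] with q h1 hq
  have hq' : (0 : ℝ) < q := by exact_mod_cast hq
  rw [survivingFraction_eq hq]
  refine ⟨div_pos (by linarith) (by positivity), le_of_eq_of_le ?_ h1.le⟩
  rw [div_div]
  congr 1
  ring

theorem eventually_lt_bpThreshold {R eps : ℝ} (hR0 : 0 < R) (hR1 : R < 1) (he0 : 0 < eps)
    (he : eps < 1 - R) :
    ∀ᶠ q : ℕ in atTop, ∀ᶠ m : ℕ in atTop, ∀ L : ℕ,
      eps ≤ bpThreshold infoTransfer infoTransfer q (1 / q) (survivingFraction R q (1 / q)) m L := by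
  -- The limit as q → ∞ of the success condition divided by (2q)²; it is equivalent to ε < 1-R.
  have hA : eps < (1 - 0) ^ 2 * ((1 - eps) * (1 - R) / R) := by
    rw [sub_zero, one_pow, one_mul, lt_div_iff₀ hR0]
    linarith
  have hlim : Tendsto (fun q : ℕ => (1 - 1 / 2 / (q : ℝ)) ^ 2 * ((1 - eps) * (1 - R) / R)) atTop
      (𝓝 ((1 - 0) ^ 2 * ((1 - eps) * (1 - R) / R))) :=
    ((tendsto_const_nhds.sub (tendsto_const_div_atTop_nhds_zero_nat _)).pow 2).mul_const _
  filter_upwards [hlim.eventually_const_lt hA, eventually_survivingFraction_mem hR0 hR1,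
    eventually_ge_atTop 2] with q hq hrho hq2
  have hq' : (0 : ℝ) < q := by exact_mod_cast (by omega : 0 < q)
  have hk : eps * (2 * q) ^ 2 <
      (2 * q - 1) ^ 2 * ((1 - eps) * survivingFraction R q (1 / q) * (2 * q)) := by
    have h1 := mul_lt_mul_of_pos_right hq (by positivity : (0 : ℝ) < (2 * q) ^ 2)
    refine h1.trans_eq ?_
    rw [survivingFraction_eq (by omega)]
    field_simp
  filter_upwards [bpSucceeds_of_potential_pos hq2 he0 (by linarith) hrho hk] with m hm L
  exact le_csSup ⟨1, fun x hx => hx.2.1⟩ ⟨he0.le, by linarith, hm L⟩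

end GSCPCC

theorem corollary1 (R : ℝ) (hR0 : 0 < R) (hR1 : R < 1) :
    -- the transfer function of the component decoder is well defined
    (∀ x ∈ Set.Icc (0 : ℝ) 1, ∀ y ∈ Set.Icc (0 : ℝ) 1,
      Tendsto (fun n : ℕ => GSCPCC.avgExtrinsicErasureProb n x y) atTop
        (𝓝 (GSCPCC.infoTransfer x y))) ∧
    -- with repetition ratio `1/q`, the punctured ensemble has rate `R` as `L → ∞`
    (∀ q : ℕ, 1 ≤ q → 1 / (q * (1 / GSCPCC.motherRate - 1) + 1) ≤ R →
      GSCPCC.survivingFraction R q (1 / q) ∈ Set.Ioc (0 : ℝ) 1 ∧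
      ∀ m : ℕ, Tendsto
        (fun L : ℕ => GSCPCC.codeRate q (1 / q) (GSCPCC.survivingFraction R q (1 / q)) m L)
        atTop (𝓝 R)) ∧
    -- its BP threshold tends to `1 - R`, the erasure probability at which the capacity is `R`
    (∀ δ : ℝ, 0 < δ → ∀ᶠ q : ℕ in atTop, ∀ᶠ m : ℕ in atTop, ∀ᶠ L : ℕ in atTop,
      |GSCPCC.bpThreshold GSCPCC.infoTransfer GSCPCC.infoTransfer q (1 / q)
          (GSCPCC.survivingFraction R q (1 / q)) m L - (1 - R)| < δ) := by
  refine ⟨fun x hx y hy => ?_, fun q hq hR => ⟨GSCPCC.survivingFraction_mem hR0 hR1 hq hR,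
    GSCPCC.tendsto_codeRate hR0 hq⟩, fun δ hδ => ?_⟩
  · rw [GSCPCC.infoTransfer_eq hx hy]
    exact GSCPCC.tendsto_avgExtrinsicErasureProb hx hy
  · obtain ⟨e, he0, heR, heδ⟩ : ∃ e, 0 < e ∧ e < 1 - R ∧ e < δ :=
      ⟨min (1 - R) δ / 2, by have := lt_min (sub_pos.2 hR1) hδ; linarith,
        by have := min_le_left (1 - R) δ; linarith, by have := min_le_right (1 - R) δ; linarith⟩
    filter_upwards [GSCPCC.eventually_lt_bpThreshold (eps := 1 - R - e) hR0 hR1 (by linarith)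
      (by linarith), GSCPCC.eventually_survivingFraction_mem hR0 hR1,
      eventually_ge_atTop 1] with q hlow hrho hq
    filter_upwards [hlow] with m hlow
    filter_upwards [GSCPCC.not_bpSucceeds_of_lt hR0 hR1 he0 hq hrho m] with L hfail
    have hup : GSCPCC.bpThreshold GSCPCC.infoTransfer GSCPCC.infoTransfer q (1 / q)
        (GSCPCC.survivingFraction R q (1 / q)) m L ≤ 1 - R + e := by
      refine Real.sSup_le (fun x hx => ?_) (by linarith)
      by_contra hlt
      exact hfail x (not_le.1 hlt).le hx.2.1 hx.2.2
    have := hlow L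
    rw [abs_lt]
    constructor <;> linarith
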